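/- Fix an integer $d\ge 2$. Let $\mathscr{A}$ be a non-empty bounded set of complex $d\times d$ matrices, let $r\in\{1,2,\dots\}\cup\{\infty\}$ be its number of elements, and let $\|\cdot\|$ be any norm on $\mathbb{C}^d$; the induced operator norm on matrices is also denoted by $\|\cdot\|$. For $n\ge 1$ let $\mathscr{A}^n$ be the set of all products of $n$ matrices from $\mathscr{A}$, put $\|\mathscr{A}^n\|=\sup_{A\in\mathscr{A}^n}\|A\|$ (so $\|\mathscr{A}\|=\|\mathscr{A}^1\|$), and let $$\rho(\mathscr{A})=\lim_{n\to\infty}\|\mathscr{A}^n\|^{1/n}$$ be the joint spectral radius; the limit exists and does not depend on the norm. Define $$C_d=\begin{cases}2^d-1 & \text{if } r=1,\\ d^{3d/2} & \text{if } r>1,\end{cases}$$ $$\sigma_d(n)=\begin{cases}\frac12\left(\frac{\ln n}{\ln 2}+1\right)\left(\frac{\ln n}{\ln 2}+2\right) & \text{if } d=2,\\ \frac{(d-1)^3}{(d-2)^2}\, n^{\ln(d-1)/\ln d} & \text{if } d>2,\end{cases}$$ $$\nu_d(n)=\begin{cases}\frac{\ln n}{\ln 2}+1 & \text{if } d=2,\\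 \frac{(d-1)^2}{d-2}\, n^{\ln(d-1)/\ln d} & \text{if } d>2.\end{cases}$$ Then for every $n\ge1$ one has $\rho(\mathscr{A})\le\|\mathscr{A}^n\|^{1/n}$, and, if $\mathscr{A}^d\ne\{0\}$, also $$C_d^{-\sigma_d(n)/n}\left(\frac{\|\mathscr{A}\|^d}{\|\mathscr{A}^d\|}\right)^{-\nu_d(n)/n}\|\mathscr{A}^n\|^{1/n}\le\rho(\mathscr{A}).$$ -/

import Mathlib

open Filter Topology
open scoped Pointwise

noncomputable section

/-- The operator norm, on complex `d × d` matrices, induced by a norm `N` on `ℂ^d`. -/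
def matNorm {d : ℕ} (N : Seminorm ℂ (Fin d → ℂ)) (A : Matrix (Fin d) (Fin d) ℂ) : ℝ :=
  sInf {c : ℝ | 0 ≤ c ∧ ∀ v : Fin d → ℂ, N (A.mulVec v) ≤ c * N v}

/-- The norm of a set of matrices: the supremum of the norms of its elements. -/
def setNorm {d : ℕ} (N : Seminorm ℂ (Fin d → ℂ)) (𝒜 : Set (Matrix (Fin d) (Fin d) ℂ)) : ℝ :=
  sSup (matNorm N '' 𝒜)

/-- A set of matrices is bounded if the entries of its elements are uniformly bounded
(in finite dimension this does not depend on the norm). -/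
def IsBoundedMatSet {d : ℕ} (𝒜 : Set (Matrix (Fin d) (Fin d) ℂ)) : Prop :=
  ∃ M : ℝ, ∀ A ∈ 𝒜, ∀ i j, ‖A i j‖ ≤ M

/-- The joint spectral radius `lim ‖𝒜ⁿ‖^{1/n}`, where `𝒜 ^ n` is the set of all products of `n`
elements of `𝒜`. The limit exists and is the same for every norm on `ℂ^d`; the maximum norm is used
here to have a definite value, and the theorem asserts the convergence for every norm. -/
def jointSpectralRadius {d : ℕ} (𝒜 : Set (Matrix (Fin d) (Fin d) ℂ)) : ℝ :=
  limUnder atTop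
    (fun n : ℕ => setNorm (normSeminorm ℂ (Fin d → ℂ)) (𝒜 ^ n) ^ (1 / (n : ℝ)))

/-- The constant `C_d`, where `r` is the (possibly infinite) number of matrices. -/
def bochiConst (d : ℕ) (r : ℕ∞) : ℝ :=
  if r = 1 then (2 : ℝ) ^ d - 1 else (d : ℝ) ^ (3 * (d : ℝ) / 2)

/-- The exponent `σ_d(n)`, for `d ≥ 2`. -/
def sigmaExp (d n : ℕ) : ℝ :=
  if d = 2 then
    1 / 2 * (Real.log n / Real.log 2 + 1) * (Real.log n / Real.log 2 + 2)
  else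
    ((d : ℝ) - 1) ^ 3 / ((d : ℝ) - 2) ^ 2 * (n : ℝ) ^ (Real.log ((d : ℝ) - 1) / Real.log d)

/-- The exponent `ν_d(n)`, for `d ≥ 2`. -/
def nuExp (d n : ℕ) : ℝ :=
  if d = 2 then
    Real.log n / Real.log 2 + 1
  else
    ((d : ℝ) - 1) ^ 2 / ((d : ℝ) - 2) * (n : ℝ) ^ (Real.log ((d : ℝ) - 1) / Real.log d)

end

/-!
The upper bound for the joint spectral radius `ρ = ρ(𝒜)` is Fekete's lemma for the submultiplicative
sequence `‖𝒜ⁿ‖`. The lower bound rests on Bochi's inequality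

  `‖𝒜ᵈ‖ ≤ C_d ρ(𝒜) ‖𝒜‖ᵈ⁻¹`.

For a single matrix `A` this follows from the theorem of Cayley and Hamilton: the coefficient of
`Aᵈ⁻ᵏ` in the characteristic polynomial is an elementary symmetric polynomial of the eigenvalues,
hence at most `(d choose k) ρᵏ`, and `ρ ≤ ‖A‖` (`setNorm_singleton_pow_le`).

For a general set, two norms on `ℂ^d` are compared: the given one and, for `c > ρ`, one in which all
matrices of `𝒜` have norm at most `c` (`exists_norm_mulVec_le`). By John's theorem
(`exists_det_ne_zero_map_mulVec_le_l2`) both are Euclidean up to the factor `√d`, and two Euclidean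
norms have common principal axes, with ratios `l i` of the lengths
(`exists_common_principal_axes`). In these coordinates an entry `A i j` with `l i ≥ l j` is
controlled by the second norm, that is by `c`. The remaining entries, those with `l i < l j`, form a
matrix such that every product of `d` matrices of this kind vanishes. Expanding a product of `d`
matrices at the first factor that is not of this kind gives the inequality
(`exists_strict_add_remainder`, `setNorm_pow_le_rpow_mul`). The constant `d ^ (3 d / 2)` requires
some care: the strict parts have Hilbert–Schmidt norm at most `β ‖𝒜‖` with `β = d - 1/2`, since one
column vanishes, and `d ^ (3/2) (1 + β + ⋯ + β ^ (d-1)) ≤ d ^ (3/2) (1 + β) ^ (d-1) ≤ d ^ (3d/2)`.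

Finally, Bochi's inequality for `𝒜ᵐ` says that `a n = ‖𝒜ⁿ‖ / ρⁿ` satisfies
`a (d m) ≤ C_d (a m) ^ (d-1)`, and for `m = 1` also that `a 1 ≤ C_d ‖𝒜‖ᵈ / ‖𝒜ᵈ‖`. Together with
submultiplicativity this bounds `a n` along the base-`d` expansion of `n`
(`le_pow_constExponent_mul_pow_ratioExponent`), and the exponents that arise are at most `σ_d(n)` and
`ν_d(n)`.
-/

/-! ### Norms on `ℂ^d` and the induced norms of sets of matrices -/

section Norms

variable {d : ℕ}

theorem Seminorm.exists_le_mul_norm (N : Seminorm ℂ (Fin d → ℂ)) :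
    ∃ K : ℝ, 0 < K ∧ ∀ v, N v ≤ K * ‖v‖ := by
  refine ⟨∑ i, N (Pi.single i 1) + 1, by positivity, fun v => ?_⟩
  have h : v = ∑ i, v i • (Pi.single i (1 : ℂ) : Fin d → ℂ) := by
    ext j
    simp [Finset.sum_apply, Pi.single_apply]
  calc N v = N (∑ i, v i • (Pi.single i (1 : ℂ) : Fin d → ℂ)) := by rw [← h]
    _ ≤ ∑ i, N (v i • (Pi.single i (1 : ℂ) : Fin d → ℂ)) :=
        Finset.le_sum_of_subadditive N (map_zero N).le (map_add_le_add N) _ _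
    _ ≤ ∑ i, N (Pi.single i 1) * ‖v‖ := by
        refine Finset.sum_le_sum fun i _ => ?_
        rw [map_smul_eq_mul, mul_comm]
        gcongr
        exact norm_le_pi_norm v i
    _ ≤ _ := by
        rw [← Finset.sum_mul]
        gcongr
        linarith

theorem Seminorm.continuous_pi (N : Seminorm ℂ (Fin d → ℂ)) : Continuous N := by
  obtain ⟨K, hK, h⟩ := N.exists_le_mul_norm
  have : LipschitzWith (Real.toNNReal K) N := by
    refine LipschitzWith.of_dist_le_mul fun x y => ?_
    rw [dist_eq_norm, dist_eq_norm, Real.coe_toNNReal _ hK.le]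
    exact (abs_sub_map_le_sub N x y).trans (h _)
  exact this.continuous

theorem Seminorm.exists_norm_le_mul (N : Seminorm ℂ (Fin d → ℂ)) (hN : ∀ v, N v = 0 → v = 0) :
    ∃ K : ℝ, 0 < K ∧ ∀ v, ‖v‖ ≤ K * N v := by
  rcases (Metric.sphere (0 : Fin d → ℂ) 1).eq_empty_or_nonempty with he | hne
  · refine ⟨1, one_pos, fun v => ?_⟩
    by_cases hv : v = 0
    · simp [hv]
    · have : (((‖v‖⁻¹ : ℝ) : ℂ) • v) ∈ Metric.sphere (0 : Fin d → ℂ) 1 := by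
        have : ‖v‖ ≠ 0 := norm_ne_zero_iff.2 hv
        simp [norm_smul, this]
      simp [he] at this
  · obtain ⟨x, hx, hmin⟩ := (isCompact_sphere (0 : Fin d → ℂ) 1).exists_isMinOn hne
      N.continuous_pi.continuousOn
    have hx1 : ‖x‖ = 1 := by simpa using hx
    have hpos : 0 < N x := by
      refine lt_of_le_of_ne (apply_nonneg N x) fun h => ?_
      rw [hN x h.symm] at hx1
      simp at hx1
    refine ⟨(N x)⁻¹, inv_pos.2 hpos, fun v => ?_⟩
    by_cases hv : v = 0
    · simp [hv]
    · have hv' : 0 < ‖v‖ := norm_pos_iff.2 hv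
      have hm : (((‖v‖⁻¹ : ℝ) : ℂ) • v) ∈ Metric.sphere (0 : Fin d → ℂ) 1 := by
        simp [norm_smul, hv'.ne']
      have h1 := hmin hm
      simp only [Set.mem_ofPred_eq, map_smul_eq_mul, Complex.norm_real, norm_inv, norm_norm] at h1
      rw [inv_mul_eq_div, le_div_iff₀ hpos]
      rw [inv_mul_eq_div, le_div_iff₀ hv'] at h1
      linarith

theorem exists_map_mulVec_le (N : Seminorm ℂ (Fin d → ℂ)) (hN : ∀ v, N v = 0 → v = 0) :
    ∃ K : ℝ, 0 < K ∧ ∀ (M : ℝ), 0 ≤ M → ∀ A : Matrix (Fin d) (Fin d) ℂ, (∀ i j, ‖A i j‖ ≤ M) →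
      ∀ v, N (A.mulVec v) ≤ K * M * N v := by
  obtain ⟨K, hK, h⟩ := N.exists_le_mul_norm
  obtain ⟨L, hL, h'⟩ := N.exists_norm_le_mul hN
  refine ⟨K * (d + 1) * L, by positivity, fun M hM A hA v => ?_⟩
  have h2 : ‖A.mulVec v‖ ≤ d * M * ‖v‖ := by
    refine (pi_norm_le_iff_of_nonneg (by positivity)).2 fun i => ?_
    calc ‖A.mulVec v i‖ ≤ ∑ j, ‖A i j * v j‖ := norm_sum_le Finset.univ fun j => A i j * v j
      _ ≤ ∑ _j : Fin d, M * ‖v‖ := by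
          refine Finset.sum_le_sum fun j _ => ?_
          rw [norm_mul]
          exact mul_le_mul (hA i j) (norm_le_pi_norm v j) (norm_nonneg _) hM
      _ = d * M * ‖v‖ := by simp; ring
  calc N (A.mulVec v) ≤ K * ‖A.mulVec v‖ := h _
    _ ≤ K * (d * M * ‖v‖) := by gcongr
    _ ≤ K * ((d + 1) * M * (L * N v)) := by
        gcongr
        · linarith
        · exact h' v
    _ = _ := by ring

theorem norm_apply_le_sum_norm (A : Matrix (Fin d) (Fin d) ℂ) (i j : Fin d) :
    ‖A i j‖ ≤ ∑ i, ∑ j, ‖A i j‖ :=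
  (Finset.single_le_sum (f := fun j => ‖A i j‖) (fun _ _ => norm_nonneg _)
    (Finset.mem_univ j)).trans (Finset.single_le_sum (f := fun i => ∑ j, ‖A i j‖)
    (fun _ _ => by positivity) (Finset.mem_univ i))

theorem matNorm_nonneg (N : Seminorm ℂ (Fin d → ℂ)) (A : Matrix (Fin d) (Fin d) ℂ) :
    0 ≤ matNorm N A := Real.sInf_nonneg fun _ hc => hc.1

theorem matNorm_le {N : Seminorm ℂ (Fin d → ℂ)} {A : Matrix (Fin d) (Fin d) ℂ} {c : ℝ}
    (hc : 0 ≤ c) (h : ∀ v, N (A.mulVec v) ≤ c * N v) : matNorm N A ≤ c :=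
  csInf_le ⟨0, fun _ hc => hc.1⟩ ⟨hc, h⟩

/-- The infimum defining the operator norm is attained. -/
theorem map_mulVec_le_matNorm {N : Seminorm ℂ (Fin d → ℂ)} (hN : ∀ v, N v = 0 → v = 0)
    (A : Matrix (Fin d) (Fin d) ℂ) (v : Fin d → ℂ) : N (A.mulVec v) ≤ matNorm N A * N v := by
  obtain ⟨K, hK, h⟩ := exists_map_mulVec_le N hN
  have hne : {c : ℝ | 0 ≤ c ∧ ∀ v : Fin d → ℂ, N (A.mulVec v) ≤ c * N v}.Nonempty := by
    exact ⟨K * ∑ i, ∑ j, ‖A i j‖, by positivity,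
      h _ (by positivity) A (norm_apply_le_sum_norm A)⟩
  rcases (apply_nonneg N v).eq_or_lt with h0 | hpos
  · rw [hN v h0.symm]
    simp
  · rw [← div_le_iff₀ hpos]
    exact le_csInf hne fun c hc => (div_le_iff₀ hpos).2 (hc.2 v)

theorem matNorm_eq_zero_iff {N : Seminorm ℂ (Fin d → ℂ)} (hN : ∀ v, N v = 0 → v = 0)
    {A : Matrix (Fin d) (Fin d) ℂ} : matNorm N A = 0 ↔ A = 0 := by
  constructor
  · intro h
    refine Matrix.ext_iff_mulVec.2 fun v => ?_
    have := map_mulVec_le_matNorm hN A v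
    rw [h, zero_mul] at this
    rw [hN _ (le_antisymm this (apply_nonneg _ _)), Matrix.zero_mulVec]
  · rintro rfl
    exact le_antisymm (matNorm_le le_rfl fun v => by simp) (matNorm_nonneg _ _)

theorem setNorm_nonneg (N : Seminorm ℂ (Fin d → ℂ)) (𝒜 : Set (Matrix (Fin d) (Fin d) ℂ)) :
    0 ≤ setNorm N 𝒜 := by
  refine Real.sSup_nonneg ?_
  rintro _ ⟨A, -, rfl⟩
  exact matNorm_nonneg N A

theorem setNorm_le {N : Seminorm ℂ (Fin d → ℂ)} {𝒜 : Set (Matrix (Fin d) (Fin d) ℂ)} {c : ℝ}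
    (hc : 0 ≤ c) (h : ∀ A ∈ 𝒜, ∀ v, N (A.mulVec v) ≤ c * N v) : setNorm N 𝒜 ≤ c := by
  refine Real.sSup_le ?_ hc
  rintro _ ⟨A, hA, rfl⟩
  exact matNorm_le hc (h A hA)

theorem IsBoundedMatSet.bddAbove {𝒜 : Set (Matrix (Fin d) (Fin d) ℂ)} (h : IsBoundedMatSet 𝒜)
    {N : Seminorm ℂ (Fin d → ℂ)} (hN : ∀ v, N v = 0 → v = 0) :
    BddAbove (matNorm N '' 𝒜) := by
  obtain ⟨M, hM⟩ := h
  obtain ⟨K, hK, h⟩ := exists_map_mulVec_le N hN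
  refine ⟨K * max M 0, ?_⟩
  rintro _ ⟨A, hA, rfl⟩
  exact matNorm_le (by positivity)
    (h _ (le_max_right _ _) A fun i j => (hM A hA i j).trans (le_max_left _ _))

theorem map_mulVec_le_setNorm {𝒜 : Set (Matrix (Fin d) (Fin d) ℂ)} (h : IsBoundedMatSet 𝒜)
    {N : Seminorm ℂ (Fin d → ℂ)} (hN : ∀ v, N v = 0 → v = 0) {A : Matrix (Fin d) (Fin d) ℂ}
    (hA : A ∈ 𝒜) (v : Fin d → ℂ) : N (A.mulVec v) ≤ setNorm N 𝒜 * N v :=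
  (map_mulVec_le_matNorm hN A v).trans <|
    mul_le_mul_of_nonneg_right (le_csSup (h.bddAbove hN) ⟨A, hA, rfl⟩) (apply_nonneg _ _)

theorem IsBoundedMatSet.mul {𝒜 ℬ : Set (Matrix (Fin d) (Fin d) ℂ)} (hA : IsBoundedMatSet 𝒜)
    (hB : IsBoundedMatSet ℬ) : IsBoundedMatSet (𝒜 * ℬ) := by
  obtain ⟨M, hM⟩ := hA
  obtain ⟨L, hL⟩ := hB
  refine ⟨d * (|M| * |L|), ?_⟩
  rintro _ ⟨A, hA, B, hB, rfl⟩ i j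
  simp only [Matrix.mul_apply]
  calc ‖∑ k, A i k * B k j‖ ≤ ∑ k, ‖A i k * B k j‖ := norm_sum_le _ _
    _ ≤ ∑ _k : Fin d, |M| * |L| := by
        refine Finset.sum_le_sum fun k _ => ?_
        rw [norm_mul]
        gcongr
        · exact (hM A hA i k).trans (le_abs_self M)
        · exact (hL B hB k j).trans (le_abs_self L)
    _ = _ := by simp

theorem IsBoundedMatSet.pow {𝒜 : Set (Matrix (Fin d) (Fin d) ℂ)} (hA : IsBoundedMatSet 𝒜)
    (n : ℕ) : IsBoundedMatSet (𝒜 ^ n) := by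
  induction n with
  | zero =>
    refine ⟨1, ?_⟩
    rw [pow_zero]
    rintro A rfl i j
    rw [Matrix.one_apply]
    split <;> simp
  | succ n ih =>
    rw [pow_succ]
    exact ih.mul hA

theorem setNorm_mul_le {𝒜 ℬ : Set (Matrix (Fin d) (Fin d) ℂ)} (hA : IsBoundedMatSet 𝒜)
    (hB : IsBoundedMatSet ℬ) {N : Seminorm ℂ (Fin d → ℂ)} (hN : ∀ v, N v = 0 → v = 0) :
    setNorm N (𝒜 * ℬ) ≤ setNorm N 𝒜 * setNorm N ℬ := by
  have h0 := setNorm_nonneg N 𝒜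
  refine setNorm_le (mul_nonneg h0 (setNorm_nonneg N ℬ)) ?_
  rintro _ ⟨A, hA', B, hB', rfl⟩ v
  dsimp only
  rw [← Matrix.mulVec_mulVec, mul_assoc]
  exact (map_mulVec_le_setNorm hA hN hA' _).trans
    (mul_le_mul_of_nonneg_left (map_mulVec_le_setNorm hB hN hB' v) h0)

theorem setNorm_pow_add_le {𝒜 : Set (Matrix (Fin d) (Fin d) ℂ)} (hA : IsBoundedMatSet 𝒜)
    {N : Seminorm ℂ (Fin d → ℂ)} (hN : ∀ v, N v = 0 → v = 0) (m n : ℕ) :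
    setNorm N (𝒜 ^ (m + n)) ≤ setNorm N (𝒜 ^ m) * setNorm N (𝒜 ^ n) := by
  rw [pow_add]
  exact setNorm_mul_le (hA.pow m) (hA.pow n) hN

theorem setNorm_pow_zero_le (𝒜 : Set (Matrix (Fin d) (Fin d) ℂ)) (N : Seminorm ℂ (Fin d → ℂ)) :
    setNorm N (𝒜 ^ 0) ≤ 1 := by
  refine setNorm_le zero_le_one ?_
  rw [pow_zero]
  rintro A rfl v
  simp

theorem setNorm_pos {𝒜 : Set (Matrix (Fin d) (Fin d) ℂ)} (hA : IsBoundedMatSet 𝒜)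
    (hne : 𝒜.Nonempty) (h0 : 𝒜 ≠ {0}) {N : Seminorm ℂ (Fin d → ℂ)}
    (hN : ∀ v, N v = 0 → v = 0) : 0 < setNorm N 𝒜 := by
  obtain ⟨A, hA', hA0⟩ : ∃ A ∈ 𝒜, A ≠ 0 := by
    by_contra! h
    exact h0 (Set.eq_singleton_iff_nonempty_unique_mem.2 ⟨hne, h⟩)
  refine lt_of_lt_of_le ?_ (le_csSup (hA.bddAbove hN) ⟨A, hA', rfl⟩)
  exact lt_of_le_of_ne (matNorm_nonneg _ _) fun h => hA0 ((matNorm_eq_zero_iff hN).1 h.symm)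

/-- Two norms on `ℂ^d` induce norms of sets of matrices that agree up to a constant factor. -/
theorem exists_setNorm_le_mul {N N' : Seminorm ℂ (Fin d → ℂ)} (hN : ∀ v, N v = 0 → v = 0)
    (hN' : ∀ v, N' v = 0 → v = 0) :
    ∃ K : ℝ, 0 < K ∧ ∀ 𝒜 : Set (Matrix (Fin d) (Fin d) ℂ), IsBoundedMatSet 𝒜 →
      setNorm N 𝒜 ≤ K * setNorm N' 𝒜 := by
  obtain ⟨K, hK, h1⟩ := N.exists_le_mul_norm
  obtain ⟨L, hL, h2⟩ := N.exists_norm_le_mul hN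
  obtain ⟨K', hK', h1'⟩ := N'.exists_le_mul_norm
  obtain ⟨L', hL', h2'⟩ := N'.exists_norm_le_mul hN'
  refine ⟨K * L' * (K' * L), by positivity, fun 𝒜 h𝒜 => ?_⟩
  have h0 := setNorm_nonneg N' 𝒜
  refine setNorm_le (by positivity) fun A hA v => ?_
  calc N (A.mulVec v) ≤ K * (L' * N' (A.mulVec v)) := (h1 _).trans (by gcongr; exact h2' _)
    _ ≤ K * (L' * (setNorm N' 𝒜 * (K' * (L * N v)))) := by
        gcongr
        refine (map_mulVec_le_setNorm h𝒜 hN' hA v).trans ?_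
        gcongr
        exact (h1' v).trans (by gcongr; exact h2 v)
    _ = _ := by ring

end Norms

/-! ### The limit defining the joint spectral radius -/

/-- For `b > 0` the sequence `max (u n) (b ^ n)` is again submultiplicative, and its logarithm is
bounded below by a linear function, so that Fekete's lemma applies even if `u` decays faster than
every geometric sequence or vanishes. -/
theorem eventually_rpow_inv_lt_of_submultiplicative {u : ℕ → ℝ} (h0 : ∀ n, 0 ≤ u n)
    (h : ∀ m n, u (m + n) ≤ u m * u n) {b c : ℝ} (hb : 0 < b) (hbc : b < c) {m : ℕ} (hm : m ≠ 0)
    (hum : u m ≤ b ^ m) : ∀ᶠ n : ℕ in atTop, u n ^ (1 / (n : ℝ)) < c := by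
  have hpos : ∀ n, 0 < max (u n) (b ^ n) := fun n => lt_max_of_lt_right (pow_pos hb n)
  have hsub : Subadditive fun n => Real.log (max (u n) (b ^ n)) := by
    intro k l
    dsimp only
    rw [← Real.log_mul (hpos k).ne' (hpos l).ne']
    refine Real.log_le_log (hpos _) (max_le ?_ ?_)
    · exact (h k l).trans (mul_le_mul (le_max_left _ _) (le_max_left _ _) (h0 l) (hpos k).le)
    · rw [pow_add]
      exact mul_le_mul (le_max_right _ _) (le_max_right _ _) (pow_nonneg hb.le l) (hpos k).le
  have hlt : Real.log (max (u m) (b ^ m)) / m < Real.log c := by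
    rw [max_eq_right hum, Real.log_pow, mul_div_cancel_left₀ _ (by exact_mod_cast hm)]
    exact Real.log_lt_log hb hbc
  filter_upwards [hsub.eventually_div_lt_of_div_lt hm hlt, eventually_ge_atTop 1] with n hn hn1
  have hn0 : (0 : ℝ) < n := by exact_mod_cast hn1
  have hc : 0 < c := hb.trans hbc
  refine (Real.rpow_le_rpow (h0 n) (le_max_left _ (b ^ n)) (by positivity)).trans_lt ?_
  rw [← Real.log_lt_log_iff (Real.rpow_pos_of_pos (hpos n) _) hc, Real.log_rpow (hpos n),
    one_div, inv_mul_eq_div]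
  exact hn

/-- Fekete's lemma for nonnegative submultiplicative sequences, without positivity. -/
theorem exists_tendsto_rpow_inv_of_submultiplicative {u : ℕ → ℝ} (h0 : ∀ n, 0 ≤ u n)
    (h : ∀ m n, u (m + n) ≤ u m * u n) :
    ∃ L : ℝ, Tendsto (fun n : ℕ => u n ^ (1 / (n : ℝ))) atTop (𝓝 L) ∧
      ∀ n : ℕ, 1 ≤ n → L ≤ u n ^ (1 / (n : ℝ)) := by
  set S := (fun n : ℕ => u n ^ (1 / (n : ℝ))) '' Set.Ici 1
  have hnn : ∀ x ∈ S, 0 ≤ x := by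
    rintro _ ⟨n, -, rfl⟩
    exact Real.rpow_nonneg (h0 n) _
  have hle : ∀ n : ℕ, 1 ≤ n → sInf S ≤ u n ^ (1 / (n : ℝ)) := fun n hn =>
    csInf_le ⟨0, hnn⟩ ⟨n, hn, rfl⟩
  refine ⟨sInf S, tendsto_order.2 ⟨fun l hl => ?_, fun c hc => ?_⟩, hle⟩
  · filter_upwards [eventually_ge_atTop 1] with n hn
    exact hl.trans_le (hle n hn)
  · obtain ⟨b, hb, hbc⟩ := exists_between hc
    obtain ⟨_, ⟨m, hm, rfl⟩, hmb⟩ := exists_lt_of_csInf_lt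
      (show S.Nonempty from ⟨_, 1, Set.self_mem_Ici, rfl⟩) hb
    have hm0 : m ≠ 0 := (lt_of_lt_of_le one_pos hm).ne'
    have hb0 : 0 < b := (Real.sInf_nonneg hnn).trans_lt hb
    refine eventually_rpow_inv_lt_of_submultiplicative h0 h hb0 hbc hm0 ?_
    rw [← Real.rpow_natCast b, ← Real.rpow_inv_le_iff_of_pos (h0 m) hb0.le (by positivity),
      ← one_div]
    exact hmb.le

section JointSpectralRadius

variable {d : ℕ} {𝒜 : Set (Matrix (Fin d) (Fin d) ℂ)} {N : Seminorm ℂ (Fin d → ℂ)}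

theorem exists_tendsto_setNorm_pow (h𝒜 : IsBoundedMatSet 𝒜) (hN : ∀ v, N v = 0 → v = 0) :
    ∃ L : ℝ, Tendsto (fun n : ℕ => setNorm N (𝒜 ^ n) ^ (1 / (n : ℝ))) atTop (𝓝 L) ∧
      ∀ n : ℕ, 1 ≤ n → L ≤ setNorm N (𝒜 ^ n) ^ (1 / (n : ℝ)) :=
  exists_tendsto_rpow_inv_of_submultiplicative (fun _ => setNorm_nonneg N _)
    (setNorm_pow_add_le h𝒜 hN)

/-- A constant factor between two norms disappears after taking `n`-th roots. -/
theorem le_of_tendsto_setNorm_pow (h𝒜 : IsBoundedMatSet 𝒜) (hN : ∀ v, N v = 0 → v = 0)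
    {N' : Seminorm ℂ (Fin d → ℂ)} (hN' : ∀ v, N' v = 0 → v = 0) {L L' : ℝ}
    (hL : Tendsto (fun n : ℕ => setNorm N (𝒜 ^ n) ^ (1 / (n : ℝ))) atTop (𝓝 L))
    (hL' : Tendsto (fun n : ℕ => setNorm N' (𝒜 ^ n) ^ (1 / (n : ℝ))) atTop (𝓝 L')) :
    L ≤ L' := by
  obtain ⟨K, hK, h⟩ := exists_setNorm_le_mul hN hN'
  have h1 : Tendsto (fun n : ℕ => K ^ (1 / (n : ℝ))) atTop (𝓝 1) := by
    have := (Real.continuousAt_const_rpow hK.ne' (b := 0)).tendsto.comp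
      tendsto_one_div_atTop_nhds_zero_nat
    simpa [Function.comp_def] using this
  have h2 := h1.mul hL'
  rw [one_mul] at h2
  refine le_of_tendsto_of_tendsto' hL h2 fun n => ?_
  rw [← Real.mul_rpow hK.le (setNorm_nonneg _ _)]
  exact Real.rpow_le_rpow (setNorm_nonneg _ _) (h _ (h𝒜.pow n)) (by positivity)

theorem tendsto_jointSpectralRadius (h𝒜 : IsBoundedMatSet 𝒜) (hN : ∀ v, N v = 0 → v = 0) :
    Tendsto (fun n : ℕ => setNorm N (𝒜 ^ n) ^ (1 / (n : ℝ))) atTop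
      (𝓝 (jointSpectralRadius 𝒜)) := by
  have hM : ∀ v, normSeminorm ℂ (Fin d → ℂ) v = 0 → v = 0 := fun v hv => norm_eq_zero.1 hv
  obtain ⟨L, hL, -⟩ := exists_tendsto_setNorm_pow h𝒜 hN
  obtain ⟨L', hL', -⟩ := exists_tendsto_setNorm_pow h𝒜 hM
  rw [jointSpectralRadius, hL'.limUnder_eq]
  rwa [(le_of_tendsto_setNorm_pow h𝒜 hM hN hL' hL).antisymm
    (le_of_tendsto_setNorm_pow h𝒜 hN hM hL hL')]

theorem jointSpectralRadius_le (h𝒜 : IsBoundedMatSet 𝒜) (hN : ∀ v, N v = 0 → v = 0) {n : ℕ}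
    (hn : 1 ≤ n) : jointSpectralRadius 𝒜 ≤ setNorm N (𝒜 ^ n) ^ (1 / (n : ℝ)) := by
  obtain ⟨L, hL, h⟩ := exists_tendsto_setNorm_pow h𝒜 hN
  rw [tendsto_nhds_unique (tendsto_jointSpectralRadius h𝒜 hN) hL]
  exact h n hn

theorem jointSpectralRadius_nonneg (h𝒜 : IsBoundedMatSet 𝒜) : 0 ≤ jointSpectralRadius 𝒜 :=
  ge_of_tendsto' (tendsto_jointSpectralRadius (N := normSeminorm ℂ (Fin d → ℂ)) h𝒜
    fun _ hv => norm_eq_zero.1 hv) fun _ => Real.rpow_nonneg (setNorm_nonneg _ _) _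

theorem jointSpectralRadius_pow_le (h𝒜 : IsBoundedMatSet 𝒜) (hN : ∀ v, N v = 0 → v = 0) {n : ℕ}
    (hn : 1 ≤ n) : jointSpectralRadius 𝒜 ^ n ≤ setNorm N (𝒜 ^ n) := by
  have hn0 : (n : ℝ) ≠ 0 := by positivity
  calc jointSpectralRadius 𝒜 ^ n ≤ (setNorm N (𝒜 ^ n) ^ (1 / (n : ℝ))) ^ n :=
        pow_le_pow_left₀ (jointSpectralRadius_nonneg h𝒜) (jointSpectralRadius_le h𝒜 hN hn) n
    _ = setNorm N (𝒜 ^ n) := by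
        rw [← Real.rpow_mul_natCast (setNorm_nonneg _ _), one_div_mul_cancel hn0, Real.rpow_one]

theorem jointSpectralRadius_le_setNorm (h𝒜 : IsBoundedMatSet 𝒜) (hN : ∀ v, N v = 0 → v = 0) :
    jointSpectralRadius 𝒜 ≤ setNorm N 𝒜 := by
  simpa using jointSpectralRadius_pow_le h𝒜 hN le_rfl

/-- The powers of a set grow at most like `c ^ n` for every `c` above the joint spectral
radius. -/
theorem exists_setNorm_pow_le (h𝒜 : IsBoundedMatSet 𝒜) (hN : ∀ v, N v = 0 → v = 0) {c : ℝ}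
    (hc : jointSpectralRadius 𝒜 < c) : ∃ M : ℝ, 0 ≤ M ∧ ∀ n, setNorm N (𝒜 ^ n) ≤ M * c ^ n := by
  have hc0 : 0 < c := (jointSpectralRadius_nonneg h𝒜).trans_lt hc
  obtain ⟨n₀, hn₀⟩ := eventually_atTop.1
    (((tendsto_jointSpectralRadius h𝒜 hN).eventually_lt_const hc).and (eventually_ge_atTop 1))
  refine ⟨1 + ∑ k ∈ Finset.range n₀, setNorm N (𝒜 ^ k) / c ^ k, ?_, fun n => ?_⟩
  · have : ∀ k, 0 ≤ setNorm N (𝒜 ^ k) / c ^ k := fun k =>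
      div_nonneg (setNorm_nonneg _ _) (by positivity)
    have := Finset.sum_nonneg fun k (_ : k ∈ Finset.range n₀) => this k
    linarith
  · have hnn : ∀ k, 0 ≤ setNorm N (𝒜 ^ k) / c ^ k := fun k =>
      div_nonneg (setNorm_nonneg _ _) (by positivity)
    rw [← div_le_iff₀ (by positivity)]
    rcases lt_or_ge n n₀ with hlt | hge
    · have := Finset.single_le_sum (fun k _ => hnn k) (Finset.mem_range.2 hlt)
      linarith
    · have hs := Finset.sum_nonneg fun k (_ : k ∈ Finset.range n₀) => hnn k
      obtain ⟨h1, h2⟩ := hn₀ n hge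
      have h3 : setNorm N (𝒜 ^ n) / c ^ n ≤ 1 := by
        rw [div_le_one (by positivity), ← Real.rpow_natCast c,
          ← Real.rpow_inv_le_iff_of_pos (setNorm_nonneg _ _) hc0.le (by positivity), ← one_div]
        exact h1.le
      linarith

theorem jointSpectralRadius_pow (h𝒜 : IsBoundedMatSet 𝒜) {m : ℕ} (hm : 1 ≤ m) :
    jointSpectralRadius (𝒜 ^ m) = jointSpectralRadius 𝒜 ^ m := by
  have hM : ∀ v, normSeminorm ℂ (Fin d → ℂ) v = 0 → v = 0 := fun v hv => norm_eq_zero.1 hv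
  have h1 := tendsto_jointSpectralRadius (h𝒜.pow m) hM
  have h2 := ((tendsto_jointSpectralRadius h𝒜 hM).comp
    (tendsto_id.const_mul_atTop' hm)).pow m
  refine tendsto_nhds_unique h1 (h2.congr fun n => ?_)
  have hm0 : (m : ℝ) ≠ 0 := by positivity
  simp only [Function.comp_apply, id_eq]
  rw [← Real.rpow_mul_natCast (setNorm_nonneg _ _), pow_mul]
  congr 1
  push_cast
  rcases eq_or_ne (n : ℝ) 0 with hn | hn
  · simp [hn]
  · field_simp

/-- The Rota–Strang construction: for every `c` above the joint spectral radius there is a norm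
with respect to which all matrices of the set have norm at most `c`, namely
`v ↦ sup {c⁻ⁿ N (P v) | P ∈ 𝒜ⁿ}`. -/
theorem exists_norm_mulVec_le (h𝒜 : IsBoundedMatSet 𝒜) (hN : ∀ v, N v = 0 → v = 0) {c : ℝ}
    (hc : jointSpectralRadius 𝒜 < c) :
    ∃ N' : Seminorm ℂ (Fin d → ℂ), (∀ v, N' v = 0 → v = 0) ∧
      ∀ A ∈ 𝒜, ∀ v, N' (A.mulVec v) ≤ c * N' v := by
  have hc0 : 0 < c := (jointSpectralRadius_nonneg h𝒜).trans_lt hc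
  obtain ⟨M, hM, h⟩ := exists_setNorm_pow_le h𝒜 hN hc
  let ι := {p : ℕ × Matrix (Fin d) (Fin d) ℂ // p.2 ∈ 𝒜 ^ p.1}
  let i₀ : ι := ⟨(0, 1), by simp⟩
  have : Nonempty ι := ⟨i₀⟩
  let f : ι → (Fin d → ℂ) → ℝ := fun i v => N (i.1.2.mulVec v) / c ^ i.1.1
  have hf0 : ∀ i v, 0 ≤ f i v := fun i v => div_nonneg (apply_nonneg _ _) (by positivity)
  have hfM : ∀ i v, f i v ≤ M * N v := by
    rintro ⟨⟨n, P⟩, hP⟩ v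
    have h1 := map_mulVec_le_setNorm (h𝒜.pow n) hN hP v
    have h2 := mul_le_mul_of_nonneg_right (h n) (apply_nonneg N v)
    simp only [f]
    rw [div_le_iff₀ (by positivity)]
    linarith
  have hbdd : ∀ v, BddAbove (Set.range fun i => f i v) := fun v =>
    ⟨M * N v, by rintro _ ⟨i, rfl⟩; exact hfM i v⟩
  let N' : Seminorm ℂ (Fin d → ℂ) := Seminorm.of (fun v => ⨆ i, f i v)
    (fun v w => by
      refine ciSup_le fun i => ?_
      refine le_trans ?_ (add_le_add (le_ciSup (hbdd v) i) (le_ciSup (hbdd w) i))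
      simp only [f]
      rw [← add_div, Matrix.mulVec_add]
      gcongr
      exact map_add_le_add _ _ _)
    (fun a v => by
      rw [Real.mul_iSup_of_nonneg (norm_nonneg a)]
      refine iSup_congr fun i => ?_
      simp only [f]
      rw [Matrix.mulVec_smul, map_smul_eq_mul, mul_div_assoc])
  refine ⟨N', fun v hv => hN v ?_, fun A hA v => ?_⟩
  · refine le_antisymm ?_ (apply_nonneg _ _)
    have h1 : f i₀ v ≤ N' v := le_ciSup (hbdd v) i₀
    simpa [f, i₀, hv] using h1
  · change (⨆ i, f i (A.mulVec v)) ≤ c * N' v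
    refine ciSup_le ?_
    rintro ⟨⟨n, P⟩, hP⟩
    have hPA : P * A ∈ 𝒜 ^ (n + 1) := by
      rw [pow_succ]
      exact Set.mul_mem_mul hP hA
    have h1 : f ⟨(n + 1, P * A), hPA⟩ v ≤ N' v := le_ciSup (hbdd v) _
    simp only [f] at h1 ⊢
    rw [div_le_iff₀ (by positivity)] at h1 ⊢
    rw [Matrix.mulVec_mulVec]
    refine h1.trans (le_of_eq ?_)
    ring

end JointSpectralRadius

/-! ### The Euclidean norm and the theorem of John -/

/-- The Euclidean norm on `ℂ^d`, as a seminorm on the space of functions `Fin d → ℂ`. -/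
noncomputable def l2 (d : ℕ) : Seminorm ℂ (Fin d → ℂ) :=
  (normSeminorm ℂ (EuclideanSpace ℂ (Fin d))).comp
    (WithLp.linearEquiv 2 ℂ (Fin d → ℂ)).symm.toLinearMap

section Euclidean

variable {d : ℕ}

theorem l2_apply (x : Fin d → ℂ) : l2 d x = ‖(WithLp.toLp 2 x : EuclideanSpace ℂ (Fin d))‖ := rfl

theorem l2_sq (x : Fin d → ℂ) : l2 d x ^ 2 = ∑ i, ‖x i‖ ^ 2 := by
  rw [l2_apply, EuclideanSpace.norm_sq_eq]

theorem l2_single (j : Fin d) : l2 d (Pi.single j 1) = 1 := by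
  have h : l2 d (Pi.single j 1) ^ 2 = 1 := by
    rw [l2_sq, Finset.sum_eq_single j]
    · simp
    · intro i _ hij
      simp [hij]
    · simp
  exact (pow_eq_one_iff_of_nonneg (apply_nonneg _ _) two_ne_zero).1 h

theorem norm_le_l2 (x : Fin d → ℂ) : ‖x‖ ≤ l2 d x := by
  refine (pi_norm_le_iff_of_nonneg (apply_nonneg _ _)).2 fun i => ?_
  refine (sq_le_sq₀ (norm_nonneg _) (apply_nonneg _ _)).1 ?_
  rw [l2_sq]
  exact Finset.single_le_sum (f := fun i => ‖x i‖ ^ 2) (fun _ _ => by positivity)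
    (Finset.mem_univ i)

theorem l2_smul_add_sq {u z : Fin d → ℂ} (hu : l2 d u = 1) (hz : star u ⬝ᵥ z = 0) (β : ℂ) :
    l2 d (β • u + z) ^ 2 = ‖β‖ ^ 2 + l2 d z ^ 2 := by
  have h : inner ℂ (WithLp.toLp 2 (β • u) : EuclideanSpace ℂ (Fin d)) (WithLp.toLp 2 z) = 0 := by
    rw [EuclideanSpace.inner_toLp_toLp, star_smul, dotProduct_comm, smul_dotProduct, hz, smul_zero]
  have h1 := norm_add_sq_eq_norm_sq_add_norm_sq_of_inner_eq_zero _ _ h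
  rw [← WithLp.toLp_add, ← l2_apply, ← l2_apply, ← l2_apply, map_smul_eq_mul, hu] at h1
  rw [sq, h1]
  ring

theorem dotProduct_star_self_of_l2_eq_one {u : Fin d → ℂ} (hu : l2 d u = 1) :
    star u ⬝ᵥ u = 1 := by
  have h := l2_sq u
  rw [hu] at h
  have h' : ((1 : ℝ) : ℂ) = ((∑ i, ‖u i‖ ^ 2 : ℝ) : ℂ) := by rw [← h]; norm_num
  rw [dotProduct]
  simp only [Pi.star_apply, RCLike.star_def, Complex.conj_mul']
  push_cast at h'
  exact h'.symm

/-- The planar estimate behind John's theorem. If the ellipse with semi-axes `a ≥ b` touches the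
tangents from the points at distance `1 / √s` on its major axis to the unit circle, then it lies in
the convex hull of the disc and these points; `κ` prescribes the splitting of the point
`(a r, b q)` into a multiple of the far point and a point of a disc. -/
theorem exists_ellipse_splitting {a b s r q : ℝ} (hs0 : 0 ≤ s) (hs1 : s < 1) (hb : 0 ≤ b)
    (hba : b ≤ a) (h : a ^ 2 * s + b ^ 2 * (1 - s) = 1) (hr : 0 ≤ r) (hq : 0 ≤ q) :
    ∃ κ, 0 ≤ κ ∧ κ ≤ a ∧
      (a - κ) * r * √s + √(κ ^ 2 * r ^ 2 + b ^ 2 * q ^ 2) ≤ √(r ^ 2 + q ^ 2) := by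
  have ha : 0 ≤ a := hb.trans hba
  obtain ⟨t, ht, rfl⟩ : ∃ t, 0 ≤ t ∧ s = t ^ 2 := ⟨√s, Real.sqrt_nonneg _, (Real.sq_sqrt hs0).symm⟩
  obtain ⟨w, hw, hw2⟩ : ∃ w, 0 < w ∧ 1 - t ^ 2 = w ^ 2 :=
    ⟨√(1 - t ^ 2), Real.sqrt_pos.2 (by linarith), (Real.sq_sqrt (by linarith)).symm⟩
  rw [Real.sqrt_sq ht]
  rw [hw2] at h
  have hab : b ^ 2 ≤ a ^ 2 := by gcongr
  have hb1 : b ^ 2 ≤ 1 := by nlinarith [mul_le_mul_of_nonneg_right hab (sq_nonneg t)]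
  have ha1 : 1 ≤ a ^ 2 := by nlinarith [mul_le_mul_of_nonneg_right hab (sq_nonneg w)]
  rcases hr.eq_or_lt with rfl | hr
  · refine ⟨a, ha, le_rfl, ?_⟩
    rw [sub_self, zero_mul, zero_mul, zero_add]
    refine Real.sqrt_le_sqrt ?_
    nlinarith [mul_le_mul_of_nonneg_right hb1 (sq_nonneg q)]
  rcases le_total (b * q * t) (a * (w * r)) with hle | hge
  · refine ⟨b * q * t / (w * r), by positivity, (div_le_iff₀ (by positivity)).2 hle, ?_⟩
    have h1 : (b * q * t / (w * r)) ^ 2 * r ^ 2 + b ^ 2 * q ^ 2 = (b * q / w) ^ 2 := by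
      field_simp
      linear_combination -(b ^ 2 * q ^ 2) * hw2
    rw [h1, Real.sqrt_sq (by positivity)]
    have h2 : (a - b * q * t / (w * r)) * r * t + b * q / w = a * r * t + b * q * w := by
      field_simp
      linear_combination (b * q) * hw2
    rw [h2]
    refine Real.le_sqrt_of_sq_le ?_
    have h3 : (a * r * t + b * q * w) ^ 2 + (a * t * q - b * w * r) ^ 2 = r ^ 2 + q ^ 2 := by
      linear_combination (r ^ 2 + q ^ 2) * h
    linarith [sq_nonneg (a * t * q - b * w * r)]
  · refine ⟨a, ha, le_rfl, ?_⟩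
    rw [sub_self, zero_mul, zero_mul, zero_add]
    refine Real.sqrt_le_sqrt ?_
    have ha0 : 0 < a := by nlinarith
    have h1 : w * r ≤ q * t := by
      refine le_of_mul_le_mul_left (hge.trans ?_) ha0
      rw [mul_assoc]
      gcongr
    have h2 : (w * r) ^ 2 ≤ (q * t) ^ 2 := by gcongr
    have h3 : (a ^ 2 - 1) * t ^ 2 = (1 - b ^ 2) * w ^ 2 := by linear_combination h + hw2
    have h4 := mul_le_mul_of_nonneg_left h2 (sub_nonneg.2 ha1)
    have h5 : w ^ 2 * ((a ^ 2 - 1) * r ^ 2) ≤ w ^ 2 * ((1 - b ^ 2) * q ^ 2) := by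
      linear_combination h4 + q ^ 2 * h3
    have h6 := le_of_mul_le_mul_left h5 (by positivity)
    linarith

theorem det_smul_one_add_smul_vecMulVec {u : Fin d → ℂ} (hu : l2 d u = 1) {a b : ℂ} (hb : b ≠ 0) :
    (b • (1 : Matrix (Fin d) (Fin d) ℂ) + (a - b) • Matrix.vecMulVec u (star u)).det =
      a * b ^ (d - 1) := by
  have hd : d ≠ 0 := by
    rintro rfl
    rw [Subsingleton.elim u 0, map_zero] at hu
    exact zero_ne_one hu
  have h : b • (1 : Matrix (Fin d) (Fin d) ℂ) + (a - b) • Matrix.vecMulVec u (star u) =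
      b • (1 + Matrix.replicateCol Unit (((a - b) / b) • u) * Matrix.replicateRow Unit (star u)) := by
    rw [← Matrix.vecMulVec_eq, Matrix.smul_vecMulVec, smul_add, smul_smul, mul_div_cancel₀ _ hb]
  rw [h, Matrix.det_smul, Matrix.det_one_add_replicateCol_mul_replicateRow, dotProduct_smul,
    dotProduct_star_self_of_l2_eq_one hu, Fintype.card_fin, smul_eq_mul, mul_one,
    one_add_div hb, add_sub_cancel]
  obtain ⟨e, rfl⟩ := Nat.exists_eq_succ_of_ne_zero hd
  rw [Nat.succ_sub_one, pow_succ]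
  field_simp

/-- If the Euclidean unit ball is contained in the unit ball of the norm `N ∘ T` and if this norm
is less than `1 / √d` at the unit vector `u`, then an ellipsoid of larger volume, stretched in
direction `u`, is contained in the unit ball as well. -/
theorem exists_larger_ellipsoid {N : Seminorm ℂ (Fin d → ℂ)} {T : Matrix (Fin d) (Fin d) ℂ}
    (hT : ∀ x, N (T.mulVec x) ≤ l2 d x) {u : Fin d → ℂ} (hu : l2 d u = 1)
    (hlt : √d * N (T.mulVec u) < 1) :
    ∃ M : Matrix (Fin d) (Fin d) ℂ, 1 < ‖M.det‖ ∧ ∀ x, N ((T * M).mulVec x) ≤ l2 d x := by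
  have hd : 1 ≤ d := by
    refine Nat.one_le_iff_ne_zero.2 ?_
    rintro rfl
    rw [Subsingleton.elim u 0, map_zero] at hu
    exact zero_ne_one hu
  have hd' : (1 : ℝ) ≤ d := by exact_mod_cast hd
  set s : ℝ := N (T.mulVec u) ^ 2 with hs
  have hs0 : 0 ≤ s := sq_nonneg _
  have hds : d * s < 1 := by
    have h1 : (√d * N (T.mulVec u)) ^ 2 < 1 :=
      pow_lt_one₀ (mul_nonneg (Real.sqrt_nonneg _) (apply_nonneg _ _)) hlt two_ne_zero
    rwa [mul_pow, Real.sq_sqrt (by positivity)] at h1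
  have hs1 : s < 1 := by nlinarith
  -- The derivative of the squared volume at `ε = 0` is `1 - d s`.
  set ε : ℝ := 1 - d * s with hε
  have hε0 : 0 < ε := by linarith
  have hε1 : ε ≤ 1 := by nlinarith
  have hsε : s * ε < 1 := by nlinarith
  obtain ⟨a, ha0, ha⟩ : ∃ a : ℝ, 0 ≤ a ∧ a ^ 2 = 1 + (1 - s) * ε :=
    ⟨√(1 + (1 - s) * ε), Real.sqrt_nonneg _, Real.sq_sqrt (by nlinarith)⟩
  obtain ⟨b, hb0, hb⟩ : ∃ b : ℝ, 0 < b ∧ b ^ 2 = 1 - s * ε :=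
    ⟨√(1 - s * ε), Real.sqrt_pos.2 (by linarith), Real.sq_sqrt (by linarith)⟩
  have hba : b ≤ a := (sq_le_sq₀ hb0.le ha0).1 (by rw [ha, hb]; nlinarith)
  refine ⟨(b : ℂ) • (1 : Matrix (Fin d) (Fin d) ℂ) +
    ((a : ℂ) - b) • Matrix.vecMulVec u (star u), ?_, fun x => ?_⟩
  · rw [det_smul_one_add_smul_vecMulVec hu (by exact_mod_cast hb0.ne'), norm_mul, norm_pow,
      Complex.norm_of_nonneg ha0, Complex.norm_of_nonneg hb0.le]
    refine (one_lt_sq_iff₀ (by positivity)).1 ?_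
    rw [mul_pow, ← pow_mul, mul_comm (d - 1), pow_mul, ha, hb]
    have hbern := one_add_mul_le_pow (a := -(s * ε)) (by linarith) (d - 1)
    rw [Nat.cast_sub hd, Nat.cast_one] at hbern
    have h1 : 0 < 1 + (1 - s) * ε := by nlinarith
    refine lt_of_lt_of_le ?_ (mul_le_mul_of_nonneg_left
      (show 1 + ((d : ℝ) - 1) * -(s * ε) ≤ (1 - s * ε) ^ (d - 1) by
        rwa [sub_eq_add_neg 1 (s * ε)]) h1.le)
    have h2 : (1 - s) * (((d : ℝ) - 1) * s) < 1 := by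
      have : ((d : ℝ) - 1) * s < 1 := by nlinarith
      have : 0 ≤ ((d : ℝ) - 1) * s := mul_nonneg (by linarith) hs0
      nlinarith
    have h3 : 0 < ε ^ 2 * (1 - (1 - s) * (((d : ℝ) - 1) * s)) := mul_pos (by positivity) (by linarith)
    have h4 : (1 + (1 - s) * ε) * (1 + ((d : ℝ) - 1) * -(s * ε)) =
        1 + ε ^ 2 * (1 - (1 - s) * (((d : ℝ) - 1) * s)) := by
      rw [hε]; ring
    linarith
  · set α : ℂ := star u ⬝ᵥ x with hα
    set z : Fin d → ℂ := x - α • u with hz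
    have huz : star u ⬝ᵥ z = 0 := by
      rw [hz, dotProduct_sub, dotProduct_smul, dotProduct_star_self_of_l2_eq_one hu, smul_eq_mul,
        mul_one, sub_self]
    have hx : x = α • u + z := by rw [hz]; abel
    have hxn : l2 d x = √(‖α‖ ^ 2 + l2 d z ^ 2) := by
      rw [← l2_smul_add_sq hu huz, ← hx, Real.sqrt_sq (apply_nonneg _ _)]
    obtain ⟨κ, hκ0, hκa, hκ⟩ := exists_ellipse_splitting hs0 hs1 hb0.le hba
      (by rw [ha, hb]; ring) (norm_nonneg α) (apply_nonneg (l2 d) z)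
    rw [hs, Real.sqrt_sq (apply_nonneg _ _)] at hκ
    have hMx : ((b : ℂ) • (1 : Matrix (Fin d) (Fin d) ℂ) +
        ((a : ℂ) - b) • Matrix.vecMulVec u (star u)).mulVec x =
        (((a - κ : ℝ) : ℂ) * α) • u + (((κ : ℂ) * α) • u + (b : ℂ) • z) := by
      rw [Matrix.add_mulVec, Matrix.smul_mulVec, Matrix.smul_mulVec, Matrix.one_mulVec,
        Matrix.vecMulVec_mulVec, ← hα, hz]
      ext i
      simp
      ring
    have hbz : star u ⬝ᵥ ((b : ℂ) • z) = 0 := by rw [dotProduct_smul, huz, smul_zero]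
    have hl : l2 d (((κ : ℂ) * α) • u + (b : ℂ) • z) =
        √(κ ^ 2 * ‖α‖ ^ 2 + b ^ 2 * l2 d z ^ 2) := by
      rw [← Real.sqrt_sq (apply_nonneg (l2 d) _), l2_smul_add_sq hu hbz, norm_mul, map_smul_eq_mul,
        Complex.norm_of_nonneg hκ0, Complex.norm_of_nonneg hb0.le, mul_pow, mul_pow]
    rw [← Matrix.mulVec_mulVec, hMx, Matrix.mulVec_add, Matrix.mulVec_smul, hxn]
    refine (map_add_le_add _ _ _).trans (le_trans (add_le_add (le_of_eq ?_) ((hT _).trans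
      (le_of_eq hl))) hκ)
    rw [map_smul_eq_mul, norm_mul, Complex.norm_of_nonneg (by linarith)]

/-- John's theorem over `ℂ`: after a linear change of coordinates, a norm on `ℂ^d` lies between
the Euclidean norm and `1 / √d` times it. The coordinates are those of an ellipsoid of maximal
volume in the unit ball. -/
theorem exists_det_ne_zero_map_mulVec_le_l2 (N : Seminorm ℂ (Fin d → ℂ))
    (hN : ∀ v, N v = 0 → v = 0) :
    ∃ T : Matrix (Fin d) (Fin d) ℂ, T.det ≠ 0 ∧
      ∀ x, N (T.mulVec x) ≤ l2 d x ∧ l2 d x ≤ √d * N (T.mulVec x) := by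
  let S : Set (Matrix (Fin d) (Fin d) ℂ) := {T | ∀ x, N (T.mulVec x) ≤ l2 d x}
  obtain ⟨K, hK, hNK⟩ := N.exists_le_mul_norm
  obtain ⟨L, hL, hLN⟩ := N.exists_norm_le_mul hN
  have hclosed : IsClosed S := by
    have : S = ⋂ x, {T | N (T.mulVec x) ≤ l2 d x} := by
      ext T
      simp [S]
    rw [this]
    refine isClosed_iInter fun x => isClosed_le ?_ continuous_const
    exact N.continuous_pi.comp (continuous_id.matrix_mulVec continuous_const)
  have hcompact : IsCompact S := by
    refine IsCompact.of_isClosed_subset (isCompact_univ_pi fun _ : Fin d =>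
      isCompact_univ_pi fun _ : Fin d => isCompact_closedBall (0 : ℂ) L) hclosed ?_
    intro T hT i _ j _
    rw [mem_closedBall_zero_iff]
    have h1 : T i j = T.mulVec (Pi.single j 1) i := by simp
    rw [h1]
    refine (norm_le_pi_norm _ i).trans ((hLN _).trans ?_)
    have := hT (Pi.single j 1)
    rw [l2_single] at this
    nlinarith
  have hmem : ((K⁻¹ : ℝ) : ℂ) • (1 : Matrix (Fin d) (Fin d) ℂ) ∈ S := by
    intro x
    rw [Matrix.smul_mulVec, Matrix.one_mulVec, map_smul_eq_mul,
      Complex.norm_of_nonneg (by positivity), inv_mul_le_iff₀ hK]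
    exact (hNK x).trans (by gcongr; exact norm_le_l2 x)
  obtain ⟨T, hT, hmax⟩ := hcompact.exists_isMaxOn ⟨_, hmem⟩
    (f := fun T : Matrix (Fin d) (Fin d) ℂ => ‖T.det‖)
    (continuous_id.matrix_det.norm.continuousOn)
  have hdet : 0 < ‖T.det‖ := by
    refine lt_of_lt_of_le ?_ (hmax hmem)
    simp [hK.ne']
  refine ⟨T, norm_pos_iff.1 hdet, fun x => ⟨hT x, ?_⟩⟩
  by_contra! hlt
  have hx : 0 < l2 d x := lt_of_le_of_lt
    (mul_nonneg (Real.sqrt_nonneg _) (apply_nonneg _ _)) hlt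
  obtain ⟨M, hM, hTM⟩ := exists_larger_ellipsoid hT (u := (((l2 d x)⁻¹ : ℝ) : ℂ) • x)
    (by rw [map_smul_eq_mul, Complex.norm_of_nonneg (by positivity), inv_mul_cancel₀ hx.ne'])
    (by
      rw [Matrix.mulVec_smul, map_smul_eq_mul, Complex.norm_of_nonneg (by positivity),
        mul_left_comm, inv_mul_lt_iff₀ hx, mul_one]
      exact hlt)
  have h1 : ‖(T * M).det‖ ≤ ‖T.det‖ := hmax hTM
  rw [Matrix.det_mul, norm_mul] at h1
  nlinarith

end Euclidean

/-! ### Simultaneous diagonalization of two norms -/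

section Bochi

variable {d : ℕ}

theorem ofReal_l2_sq (x : Fin d → ℂ) : ((l2 d x ^ 2 : ℝ) : ℂ) = star x ⬝ᵥ x := by
  rw [l2_sq, dotProduct]
  simp only [Pi.star_apply, RCLike.star_def, Complex.conj_mul']
  push_cast
  rfl

theorem ofReal_l2_mulVec_sq (M : Matrix (Fin d) (Fin d) ℂ) (x : Fin d → ℂ) :
    ((l2 d (M.mulVec x) ^ 2 : ℝ) : ℂ) = star x ⬝ᵥ (M.conjTranspose * M).mulVec x := by
  rw [ofReal_l2_sq, Matrix.star_mulVec, ← Matrix.mulVec_mulVec, 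
    Matrix.dotProduct_mulVec _ M.conjTranspose]

open scoped ComplexOrder in
/-- Two norms on `ℂ^d` have a common system of coordinates in which both are, up to the factor
`√d`, Euclidean norms with the coordinate axes as principal axes. -/
theorem exists_common_principal_axes {N₁ N₂ : Seminorm ℂ (Fin d → ℂ)}
    (h₁ : ∀ v, N₁ v = 0 → v = 0) (h₂ : ∀ v, N₂ v = 0 → v = 0) :
    ∃ (B : Matrix (Fin d) (Fin d) ℂ) (l : Fin d → ℝ), B.det ≠ 0 ∧ (∀ i, 0 < l i) ∧
      ∀ x, N₁ (B.mulVec x) ≤ l2 d x ∧ l2 d x ≤ √d * N₁ (B.mulVec x) ∧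
        N₂ (B.mulVec x) ≤ l2 d (fun i => l i * x i) ∧
        l2 d (fun i => l i * x i) ≤ √d * N₂ (B.mulVec x) := by
  obtain ⟨T₁, hT₁, hN₁⟩ := exists_det_ne_zero_map_mulVec_le_l2 N₁ h₁
  obtain ⟨T₂, hT₂, hN₂⟩ := exists_det_ne_zero_map_mulVec_le_l2 N₂ h₂
  set G := T₂⁻¹ * T₁ with hG
  have hGu : IsUnit G := by
    rw [Matrix.isUnit_iff_isUnit_det, hG, Matrix.det_mul, Matrix.det_nonsing_inv]
    exact (IsUnit.mk0 _ hT₂).ringInverse.mul (IsUnit.mk0 _ hT₁)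
  have hpos : (G.conjTranspose * G).PosDef :=
    Matrix.PosDef.conjTranspose_mul_self G (Matrix.mulVec_injective_of_isUnit hGu)
  set U : Matrix (Fin d) (Fin d) ℂ := hpos.isHermitian.eigenvectorUnitary.1 with hU
  have hUU : U.conjTranspose * U = 1 :=
    Unitary.coe_star_mul_self hpos.isHermitian.eigenvectorUnitary
  have hdiag : U.conjTranspose * (G.conjTranspose * G) * U =
      Matrix.diagonal (fun i => (hpos.isHermitian.eigenvalues i : ℂ)) := by
    have := hpos.isHermitian.conjStarAlgAut_star_eigenvectorUnitary
    rw [Unitary.conjStarAlgAut_star_apply] at this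
    exact this
  have hGT : T₂ * (G * U) = T₁ * U := by
    rw [hG, ← mul_assoc, ← mul_assoc, Matrix.mul_nonsing_inv _ (IsUnit.mk0 _ hT₂), one_mul]
  have hl2U : ∀ x, l2 d (U.mulVec x) = l2 d x := fun x => by
    have h := ofReal_l2_mulVec_sq U x
    rw [hUU, Matrix.one_mulVec, ← ofReal_l2_sq] at h
    exact (sq_eq_sq₀ (apply_nonneg _ _) (apply_nonneg _ _)).1 (Complex.ofReal_injective h)
  have hl2G : ∀ x, l2 d ((G * U).mulVec x) =
      l2 d (fun i => (√(hpos.isHermitian.eigenvalues i) : ℝ) * x i) := fun x => by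
    have h := ofReal_l2_mulVec_sq (G * U) x
    have h' : (G * U).conjTranspose * (G * U) = U.conjTranspose * (G.conjTranspose * G) * U := by
      rw [Matrix.conjTranspose_mul]
      simp only [mul_assoc]
    rw [h', hdiag] at h
    refine (sq_eq_sq₀ (apply_nonneg _ _) (apply_nonneg _ _)).1 (Complex.ofReal_injective ?_)
    rw [h, ofReal_l2_sq, dotProduct, dotProduct]
    refine Finset.sum_congr rfl fun i _ => ?_
    rw [Matrix.mulVec_diagonal]
    have hs : ((√(hpos.isHermitian.eigenvalues i) : ℝ) : ℂ) ^ 2 = hpos.isHermitian.eigenvalues i := by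
      rw [← Complex.ofReal_pow, Real.sq_sqrt (hpos.eigenvalues_pos i).le]
    rw [← hs]
    simp only [Pi.star_apply, star_mul', RCLike.star_def, Complex.conj_ofReal]
    ring
  refine ⟨T₁ * U, fun i => √(hpos.isHermitian.eigenvalues i), ?_,
    fun i => Real.sqrt_pos.2 (hpos.eigenvalues_pos i), fun x => ⟨?_, ?_, ?_, ?_⟩⟩
  · rw [Matrix.det_mul]
    refine mul_ne_zero hT₁ fun h0 => ?_
    have := congrArg Matrix.det hUU
    rw [Matrix.det_mul, h0, mul_zero, Matrix.det_one] at this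
    exact zero_ne_one this
  · rw [← Matrix.mulVec_mulVec, ← hl2U x]
    exact (hN₁ _).1
  · rw [← Matrix.mulVec_mulVec, ← hl2U x]
    exact (hN₁ _).2
  · rw [← hGT, ← Matrix.mulVec_mulVec, ← hl2G]
    exact (hN₂ _).1
  · rw [← hGT, ← Matrix.mulVec_mulVec, ← hl2G]
    exact (hN₂ _).2

/-! ### The inequality of Bochi -/

/-- The Euclidean operator norm is at most the Hilbert–Schmidt norm. -/
theorem l2_mulVec_le_of_sum_sq_le {M : Matrix (Fin d) (Fin d) ℂ} {K : ℝ} (hK : 0 ≤ K)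
    (h : ∑ j, ∑ i, ‖M i j‖ ^ 2 ≤ K ^ 2) (x : Fin d → ℂ) : l2 d (M.mulVec x) ≤ K * l2 d x := by
  refine (sq_le_sq₀ (apply_nonneg _ _) (mul_nonneg hK (apply_nonneg _ _))).1 ?_
  rw [mul_pow, l2_sq, l2_sq]
  calc ∑ i, ‖M.mulVec x i‖ ^ 2 ≤ ∑ i, (∑ j, ‖M i j‖ ^ 2) * ∑ j, ‖x j‖ ^ 2 := by
        refine Finset.sum_le_sum fun i _ => ?_
        refine le_trans ?_ (Finset.sum_mul_sq_le_sq_mul_sq Finset.univ (fun j => ‖M i j‖)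
          fun j => ‖x j‖)
        refine pow_le_pow_left₀ (norm_nonneg _) ?_ 2
        refine (norm_sum_le Finset.univ fun j => M i j * x j).trans (le_of_eq ?_)
        simp
    _ = (∑ j, ∑ i, ‖M i j‖ ^ 2) * ∑ j, ‖x j‖ ^ 2 := by rw [← Finset.sum_mul, Finset.sum_comm]
    _ ≤ _ := by gcongr

theorem sum_norm_sq_col (M : Matrix (Fin d) (Fin d) ℂ) (j : Fin d) :
    ∑ i, ‖M i j‖ ^ 2 = l2 d (M.mulVec (Pi.single j 1)) ^ 2 := by
  rw [l2_sq]
  simp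

/-- The part of a matrix with entries at the places `(i, j)` such that `l i < l j`. -/
noncomputable def strictPart (l : Fin d → ℝ) (M : Matrix (Fin d) (Fin d) ℂ) : Matrix (Fin d) (Fin d) ℂ :=
  Matrix.of fun i j => if l i < l j then M i j else 0

/-- A column of the strict part vanishes, whence the factor `√(d - 1)` instead of `√d`. -/
theorem l2_strictPart_mulVec_le (hd : 1 ≤ d) (l : Fin d → ℝ) {M : Matrix (Fin d) (Fin d) ℂ} {α : ℝ}
    (hα : 0 ≤ α) (hM : ∀ x, l2 d (M.mulVec x) ≤ α * l2 d x) (x : Fin d → ℂ) :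
    l2 d ((strictPart l M).mulVec x) ≤ √((d : ℝ) - 1) * α * l2 d x := by
  have hd' : (1 : ℝ) ≤ d := by exact_mod_cast hd
  refine l2_mulVec_le_of_sum_sq_le (by positivity) ?_ x
  rw [mul_pow, Real.sq_sqrt (by linarith)]
  have : Nonempty (Fin d) := ⟨⟨0, hd⟩⟩
  obtain ⟨j₀, -, hj₀⟩ := Finset.exists_min_image Finset.univ l Finset.univ_nonempty
  rw [← Finset.add_sum_erase _ _ (Finset.mem_univ j₀)]
  have h0 : ∑ i, ‖strictPart l M i j₀‖ ^ 2 = 0 := by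
    refine Finset.sum_eq_zero fun i hi => ?_
    simp [strictPart, (hj₀ i hi).not_gt]
  have hcol : ∀ j, ∑ i, ‖strictPart l M i j‖ ^ 2 ≤ α ^ 2 := fun j => by
    calc ∑ i, ‖strictPart l M i j‖ ^ 2 ≤ ∑ i, ‖M i j‖ ^ 2 := by
          refine Finset.sum_le_sum fun i _ => ?_
          simp only [strictPart, Matrix.of_apply]
          split
          · exact le_rfl
          · simp
      _ ≤ α ^ 2 := by
          rw [sum_norm_sq_col]
          have := hM (Pi.single j 1)
          rw [l2_single, mul_one] at this
          exact pow_le_pow_left₀ (apply_nonneg _ _) this 2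
  rw [h0, zero_add]
  refine (Finset.sum_le_card_nsmul _ _ _ fun j _ => hcol j).trans (le_of_eq ?_)
  rw [Finset.card_erase_of_mem (Finset.mem_univ _), Finset.card_univ, Fintype.card_fin, nsmul_eq_mul,
    Nat.cast_sub hd, Nat.cast_one]

/-- The entries outside the strict part do not decrease under conjugation with the diagonal matrix
`diag l`. -/
theorem l2_sub_strictPart_mulVec_le {l : Fin d → ℝ} (hl : ∀ i, 0 < l i)
    {M : Matrix (Fin d) (Fin d) ℂ} {γ : ℝ} (hγ : 0 ≤ γ)
    (hM : ∀ x, l2 d (fun i => l i * M.mulVec x i) ≤ γ * l2 d (fun i => l i * x i))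
    (x : Fin d → ℂ) : l2 d ((M - strictPart l M).mulVec x) ≤ √d * γ * l2 d x := by
  refine l2_mulVec_le_of_sum_sq_le (by positivity) ?_ x
  rw [mul_pow, Real.sq_sqrt (by positivity)]
  have hcol : ∀ j, ∑ i, ‖(M - strictPart l M) i j‖ ^ 2 ≤ γ ^ 2 := fun j => by
    have h1 := hM (Pi.single j 1)
    have h2 : l2 d (fun i => l i * (Pi.single j 1 : Fin d → ℂ) i) = l j := by
      have : (fun i => l i * (Pi.single j 1 : Fin d → ℂ) i) = (l j : ℂ) • Pi.single j 1 := by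
        ext i
        rcases eq_or_ne i j with rfl | hij
        · simp
        · simp [hij]
      rw [this, map_smul_eq_mul, l2_single, mul_one, Complex.norm_of_nonneg (hl j).le]
    rw [h2] at h1
    have h3 := pow_le_pow_left₀ (apply_nonneg _ _) h1 2
    rw [l2_sq, mul_pow] at h3
    refine le_of_mul_le_mul_right ?_ (pow_pos (hl j) 2)
    refine le_trans ?_ h3
    rw [Finset.sum_mul]
    refine Finset.sum_le_sum fun i _ => ?_
    rw [norm_mul, mul_pow, Complex.norm_of_nonneg (hl i).le, mul_comm]
    simp only [strictPart, Matrix.sub_apply, Matrix.of_apply, Matrix.mulVec_single_one,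
      Matrix.col_apply]
    split
    · rw [sub_self, norm_zero, zero_pow two_ne_zero, mul_zero]
      positivity
    · rename_i hij
      rw [sub_zero]
      have := (hl j).le
      gcongr
      exact not_lt.1 hij
  refine (Finset.sum_le_card_nsmul _ _ _ fun j _ => hcol j).trans (le_of_eq ?_)
  rw [Finset.card_univ, Fintype.card_fin, nsmul_eq_mul]

theorem geom_sum_le_one_add_pow {β : ℝ} (hβ : 0 ≤ β) (n : ℕ) :
    ∑ k ∈ Finset.range (n + 1), β ^ k ≤ (1 + β) ^ n := by
  induction n with
  | zero => simp
  | succ n ih =>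
    rw [Finset.sum_range_succ, pow_succ (1 + β)]
    have : β ^ n ≤ (1 + β) ^ n := by gcongr; linarith
    calc _ ≤ (1 + β) ^ n + (1 + β) ^ n * β := by
          rw [pow_succ]
          gcongr
      _ = _ := by ring

/-- The number of indices `j` with `l j < l i`. -/
noncomputable def rankBelow (l : Fin d → ℝ) (i : Fin d) : ℕ :=
  (Finset.univ.filter fun j => l j < l i).card

theorem rankBelow_lt {l : Fin d → ℝ} {i j : Fin d} (h : l i < l j) :
    rankBelow l i < rankBelow l j := by
  refine Finset.card_lt_card (Finset.ssubset_iff_of_subset ?_ |>.2 ⟨i, by simpa, by simp⟩)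
  intro k hk
  simp only [Finset.mem_filter, Finset.mem_univ, true_and] at hk ⊢
  exact hk.trans h

theorem rankBelow_lt_card (l : Fin d → ℝ) (i : Fin d) : rankBelow l i < d := by
  have : rankBelow l i < (Finset.univ : Finset (Fin d)).card := by
    refine Finset.card_lt_card (Finset.ssubset_iff_of_subset (Finset.filter_subset _ _) |>.2
      ⟨i, by simp, by simp⟩)
  simpa using this

/-- A product of `k` matrices is the sum of a product `V` of `k` strict parts and a remainder `W`.
Each summand of the remainder, expanded at the first factor that is not a strict part, contains one
factor that is controlled by the second norm; the factors to its right are kept together and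
estimated in the first norm. -/
theorem exists_strict_add_remainder (hd : 1 ≤ d) {N₁ N₂ : Seminorm ℂ (Fin d → ℂ)}
    {B : Matrix (Fin d) (Fin d) ℂ} (hB : B.det ≠ 0) {l : Fin d → ℝ} (hl : ∀ i, 0 < l i)
    (hBl : ∀ x, N₁ (B.mulVec x) ≤ l2 d x ∧ l2 d x ≤ √d * N₁ (B.mulVec x) ∧
        N₂ (B.mulVec x) ≤ l2 d (fun i => l i * x i) ∧
        l2 d (fun i => l i * x i) ≤ √d * N₂ (B.mulVec x))
    {𝒜 : Set (Matrix (Fin d) (Fin d) ℂ)} {a c : ℝ} (ha : 0 ≤ a) (hc : 0 ≤ c)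
    (hA₁ : ∀ A ∈ 𝒜, ∀ v, N₁ (A.mulVec v) ≤ a * N₁ v)
    (hA₂ : ∀ A ∈ 𝒜, ∀ v, N₂ (A.mulVec v) ≤ c * N₂ v) (k : ℕ) :
    ∀ P ∈ 𝒜 ^ k, ∃ V W : Matrix (Fin d) (Fin d) ℂ,
      P * B = B * (V + W) ∧
      (∀ i j, V i j ≠ 0 → rankBelow l i + k ≤ rankBelow l j) ∧
      (∀ x, l2 d (V.mulVec x) ≤ (((d : ℝ) - 1 / 2) * a) ^ k * l2 d x) ∧
      ∀ x, l2 d (W.mulVec x) ≤ d * √d * c *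
        ((∑ i ∈ Finset.range k, ((d : ℝ) - 1 / 2) ^ i) * a ^ (k - 1)) * N₁ (B.mulVec x) := by
  have hd' : (1 : ℝ) ≤ d := by exact_mod_cast hd
  have hβ0 : 0 ≤ (d : ℝ) - 1 / 2 := by linarith
  induction k with
  | zero =>
    rw [pow_zero]
    rintro P rfl
    refine ⟨1, 0, by simp, fun i j hij => ?_, fun x => by simp, fun x => by simp⟩
    rcases eq_or_ne i j with rfl | hne
    · simp
    · exact absurd (Matrix.one_apply_ne hne) hij
  | succ k ih =>
    rw [pow_succ]
    rintro _ ⟨P, hP, A, hA, rfl⟩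
    obtain ⟨V, W, hPB, hchain, hV, hW⟩ := ih P hP
    set A' := B⁻¹ * (A * B) with hA'
    have hBA : A * B = B * A' := by
      rw [hA', Matrix.mul_nonsing_inv_cancel_left _ _ (IsUnit.mk0 _ hB)]
    have hBAx : ∀ x, B.mulVec (A'.mulVec x) = A.mulVec (B.mulVec x) := fun x => by
      rw [Matrix.mulVec_mulVec, Matrix.mulVec_mulVec, hBA]
    set U := strictPart l A' with hU
    have hUx : ∀ x, l2 d (U.mulVec x) ≤ ((d : ℝ) - 1 / 2) * a * l2 d x := fun x => by
      refine (l2_strictPart_mulVec_le hd l (α := √d * a) (by positivity) (fun y => ?_) x).trans ?_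
      · calc l2 d (A'.mulVec y) ≤ √d * N₁ (A.mulVec (B.mulVec y)) := by
              rw [← hBAx]
              exact (hBl _).2.1
          _ ≤ √d * (a * l2 d y) := by
              gcongr
              exact (hA₁ A hA _).trans (by gcongr; exact (hBl _).1)
          _ = √d * a * l2 d y := by ring
      · rw [← mul_assoc]
        gcongr
        rw [← Real.sqrt_mul (by linarith)]
        exact Real.sqrt_le_iff.2 ⟨hβ0, by nlinarith⟩
    have hLx : ∀ x, l2 d ((A' - U).mulVec x) ≤ d * c * l2 d x := fun x => by
      refine (l2_sub_strictPart_mulVec_le hl (γ := √d * c) (by positivity) (fun y => ?_) x).trans ?_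
      · calc l2 d (fun i => l i * A'.mulVec y i) ≤ √d * N₂ (A.mulVec (B.mulVec y)) := by
              rw [← hBAx]
              exact (hBl _).2.2.2
          _ ≤ √d * (c * l2 d (fun i => l i * y i)) := by
              gcongr
              exact (hA₂ A hA _).trans (by gcongr; exact (hBl _).2.2.1)
          _ = _ := by ring
      · rw [← mul_assoc, Real.mul_self_sqrt (by linarith)]
    refine ⟨V * U, V * (A' - U) + W * A', ?_, fun i j hij => ?_, fun x => ?_, fun x => ?_⟩
    · dsimp only
      rw [mul_assoc, hBA, ← mul_assoc, hPB]
      noncomm_ring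
    · rw [Matrix.mul_apply] at hij
      obtain ⟨m, -, hm⟩ := Finset.exists_ne_zero_of_sum_ne_zero hij
      have h1 := hchain i m (left_ne_zero_of_mul hm)
      have h2 : l m < l j := by
        by_contra hlt
        exact right_ne_zero_of_mul hm (by simp [hU, strictPart, hlt])
      have := rankBelow_lt h2
      omega
    · rw [← Matrix.mulVec_mulVec, pow_succ, mul_assoc]
      exact (hV _).trans (by gcongr; exact hUx x)
    · rw [Matrix.add_mulVec, ← Matrix.mulVec_mulVec, ← Matrix.mulVec_mulVec]
      have hN := apply_nonneg N₁ (B.mulVec x)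
      have h1 : l2 d (V.mulVec ((A' - U).mulVec x)) ≤
          (((d : ℝ) - 1 / 2) * a) ^ k * (d * c * (√d * N₁ (B.mulVec x))) :=
        (hV _).trans (by gcongr; exact (hLx x).trans (by gcongr; exact (hBl x).2.1))
      have hS : 0 ≤ ∑ i ∈ Finset.range k, ((d : ℝ) - 1 / 2) ^ i := by positivity
      have h2 : l2 d (W.mulVec (A'.mulVec x)) ≤ d * √d * c *
          ((∑ i ∈ Finset.range k, ((d : ℝ) - 1 / 2) ^ i) * a ^ (k - 1)) *
            (a * N₁ (B.mulVec x)) := by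
        refine (hW _).trans ?_
        gcongr
        rw [hBAx]
        exact hA₁ A hA _
      have h3 : (∑ i ∈ Finset.range k, ((d : ℝ) - 1 / 2) ^ i) * a ^ (k - 1) * a =
          (∑ i ∈ Finset.range k, ((d : ℝ) - 1 / 2) ^ i) * a ^ k := by
        rcases k with _ | k
        · simp
        · rw [Nat.add_sub_cancel, pow_succ, mul_assoc]
      refine (map_add_le_add _ _ _).trans ((add_le_add h1 h2).trans (le_of_eq ?_))
      rw [Finset.sum_range_succ, Nat.add_sub_cancel, mul_pow]
      linear_combination (d * √d * c * N₁ (B.mulVec x)) * h3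

/-- The numerical constant: `β = d - 1/2` satisfies `1 + β ≤ d ^ (3/2)`. -/
theorem mul_sqrt_mul_geom_sum_le (hd : 2 ≤ d) :
    d * √d * ∑ i ∈ Finset.range d, ((d : ℝ) - 1 / 2) ^ i ≤ (d : ℝ) ^ (3 * (d : ℝ) / 2) := by
  have hd' : (2 : ℝ) ≤ d := by exact_mod_cast hd
  have hs : 0 ≤ √(d : ℝ) := Real.sqrt_nonneg _
  have hs2 : √(d : ℝ) ^ 2 = d := Real.sq_sqrt (by linarith)
  have h1 : 1 + ((d : ℝ) - 1 / 2) ≤ d * √d := by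
    refine (sq_le_sq₀ (by linarith) (by positivity)).1 ?_
    rw [mul_pow, hs2]
    nlinarith
  obtain ⟨e, rfl⟩ : ∃ e, d = e + 1 := ⟨d - 1, by omega⟩
  have h2 := geom_sum_le_one_add_pow (β := ((e + 1 : ℕ) : ℝ) - 1 / 2) (by linarith) e
  have h3 : (((e + 1 : ℕ) : ℝ)) ^ (3 * ((e + 1 : ℕ) : ℝ) / 2) =
      (((e + 1 : ℕ) : ℝ) * √((e + 1 : ℕ) : ℝ)) ^ (e + 1) := by
    rw [Real.sqrt_eq_rpow, ← Real.rpow_one_add' (by positivity) (by norm_num),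
      ← Real.rpow_mul_natCast (by positivity)]
    congr 1
    ring
  rw [h3, pow_succ, mul_comm]
  gcongr
  exact h2.trans (pow_le_pow_left₀ (by linarith) h1 e)

/-- Bochi's inequality for two norms: in a product of `d` matrices one factor may be measured in the
second norm. No product of `d` strict parts survives, so only the remainder contributes. -/
theorem map_mulVec_le_of_mem_pow (hd : 2 ≤ d) {N₁ N₂ : Seminorm ℂ (Fin d → ℂ)}
    (h₁ : ∀ v, N₁ v = 0 → v = 0) (h₂ : ∀ v, N₂ v = 0 → v = 0)
    {𝒜 : Set (Matrix (Fin d) (Fin d) ℂ)} {a c : ℝ} (ha : 0 ≤ a) (hc : 0 ≤ c)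
    (hA₁ : ∀ A ∈ 𝒜, ∀ v, N₁ (A.mulVec v) ≤ a * N₁ v)
    (hA₂ : ∀ A ∈ 𝒜, ∀ v, N₂ (A.mulVec v) ≤ c * N₂ v) {P : Matrix (Fin d) (Fin d) ℂ}
    (hP : P ∈ 𝒜 ^ d) (v : Fin d → ℂ) :
    N₁ (P.mulVec v) ≤ (d : ℝ) ^ (3 * (d : ℝ) / 2) * c * a ^ (d - 1) * N₁ v := by
  obtain ⟨B, l, hB, hl, hBl⟩ := exists_common_principal_axes h₁ h₂
  obtain ⟨V, W, hPB, hchain, -, hW⟩ :=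
    exists_strict_add_remainder (by omega) hB hl hBl ha hc hA₁ hA₂ d P hP
  have hV : V = 0 := by
    ext i j
    by_contra hij
    have h1 := hchain i j hij
    have h2 := rankBelow_lt_card l j
    omega
  obtain ⟨x, rfl⟩ : ∃ x, v = B.mulVec x :=
    ⟨B⁻¹.mulVec v, by rw [Matrix.mulVec_mulVec, Matrix.mul_nonsing_inv _ (IsUnit.mk0 _ hB),
      Matrix.one_mulVec]⟩
  rw [Matrix.mulVec_mulVec, hPB, hV, zero_add, ← Matrix.mulVec_mulVec]
  refine (hBl _).1.trans ((hW x).trans ?_)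
  have hN := apply_nonneg N₁ (B.mulVec x)
  calc _ = d * √d * (∑ i ∈ Finset.range d, ((d : ℝ) - 1 / 2) ^ i) *
        (c * a ^ (d - 1) * N₁ (B.mulVec x)) := by ring
    _ ≤ (d : ℝ) ^ (3 * (d : ℝ) / 2) * (c * a ^ (d - 1) * N₁ (B.mulVec x)) := by
        gcongr
        exact mul_sqrt_mul_geom_sum_le hd
    _ = _ := by ring

/-- Bochi's inequality for an arbitrary bounded set: the norm-wise estimate is applied to norms in
which the set has norm at most `c`, and `c` tends to the joint spectral radius. -/
theorem setNorm_pow_le_rpow_mul (hd : 2 ≤ d) {𝒜 : Set (Matrix (Fin d) (Fin d) ℂ)}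
    (h𝒜 : IsBoundedMatSet 𝒜) {N : Seminorm ℂ (Fin d → ℂ)} (hN : ∀ v, N v = 0 → v = 0) :
    setNorm N (𝒜 ^ d) ≤
      (d : ℝ) ^ (3 * (d : ℝ) / 2) * jointSpectralRadius 𝒜 * setNorm N 𝒜 ^ (d - 1) := by
  have key : ∀ c, jointSpectralRadius 𝒜 < c →
      setNorm N (𝒜 ^ d) ≤ (d : ℝ) ^ (3 * (d : ℝ) / 2) * c * setNorm N 𝒜 ^ (d - 1) := by
    intro c hc
    have hc0 : 0 ≤ c := (jointSpectralRadius_nonneg h𝒜).trans hc.le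
    have ha := setNorm_nonneg N 𝒜
    obtain ⟨N', hN', hA'⟩ := exists_norm_mulVec_le h𝒜 hN hc
    exact setNorm_le (by positivity) fun P hP v =>
      map_mulVec_le_of_mem_pow hd hN hN' ha hc0 (fun A hA => map_mulVec_le_setNorm h𝒜 hN hA)
        hA' hP v
  have hcont : Continuous fun c : ℝ =>
      (d : ℝ) ^ (3 * (d : ℝ) / 2) * c * setNorm N 𝒜 ^ (d - 1) := by fun_prop
  refine ge_of_tendsto (hcont.continuousWithinAt (s := Set.Ioi (jointSpectralRadius 𝒜))).tendsto ?_
  filter_upwards [self_mem_nhdsWithin] with c hc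
  exact key c hc

end Bochi

/-! ### Bochi's inequality for a single matrix -/

section Singleton

variable {d : ℕ}

theorem setNorm_singleton (N : Seminorm ℂ (Fin d → ℂ)) (A : Matrix (Fin d) (Fin d) ℂ) :
    setNorm N {A} = matNorm N A := by
  rw [setNorm, Set.image_singleton, csSup_singleton]

theorem isBoundedMatSet_singleton (A : Matrix (Fin d) (Fin d) ℂ) : IsBoundedMatSet {A} := by
  refine ⟨∑ i, ∑ j, ‖A i j‖, fun A' hA' => ?_⟩
  rw [Set.mem_singleton_iff.1 hA']
  exact norm_apply_le_sum_norm A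

theorem norm_le_jointSpectralRadius_of_isRoot_charpoly {A : Matrix (Fin d) (Fin d) ℂ} {μ : ℂ}
    (h : A.charpoly.IsRoot μ) : ‖μ‖ ≤ jointSpectralRadius {A} := by
  rw [Polynomial.IsRoot, Matrix.eval_charpoly] at h
  obtain ⟨v, hv, hAv⟩ := Matrix.exists_mulVec_eq_zero_iff.2 h
  have hAv' : A.mulVec v = μ • v := by
    rw [Matrix.sub_mulVec, sub_eq_zero] at hAv
    rw [← hAv, Matrix.scalar_apply, ← Matrix.smul_one_eq_diagonal, Matrix.smul_mulVec,
      Matrix.one_mulVec]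
  have hpow : ∀ n : ℕ, (A ^ n).mulVec v = μ ^ n • v := fun n => by
    induction n with
    | zero => simp
    | succ n ih => rw [pow_succ, ← Matrix.mulVec_mulVec, hAv', Matrix.mulVec_smul, ih, smul_smul,
        ← pow_succ']
  have hM : ∀ v, normSeminorm ℂ (Fin d → ℂ) v = 0 → v = 0 := fun v hv => norm_eq_zero.1 hv
  refine ge_of_tendsto (tendsto_jointSpectralRadius (isBoundedMatSet_singleton A) hM) ?_
  filter_upwards [eventually_ge_atTop 1] with n hn
  have hn0 : (n : ℝ) ≠ 0 := by positivity
  rw [Set.singleton_pow, setNorm_singleton]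
  have h1 := map_mulVec_le_matNorm hM (A ^ n) v
  rw [hpow, map_smul_eq_mul, norm_pow] at h1
  have h2 := le_of_mul_le_mul_right h1 (norm_pos_iff.2 hv)
  calc ‖μ‖ = (‖μ‖ ^ n) ^ (1 / (n : ℝ)) := by
        rw [← Real.rpow_natCast, ← Real.rpow_mul (norm_nonneg _), mul_one_div_cancel hn0,
          Real.rpow_one]
    _ ≤ _ := Real.rpow_le_rpow (by positivity) h2 (by positivity)

/-- For a single matrix, Bochi's inequality holds with the constant `2 ^ d - 1`: by the theorem of
Cayley and Hamilton, `A ^ d` is a combination of lower powers of `A`, with elementary symmetric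
polynomials of the eigenvalues as coefficients. -/
theorem setNorm_singleton_pow_le (hd : 1 ≤ d) (A : Matrix (Fin d) (Fin d) ℂ)
    {N : Seminorm ℂ (Fin d → ℂ)} (hN : ∀ v, N v = 0 → v = 0) :
    setNorm N ({A} ^ d) ≤
      ((2 : ℝ) ^ d - 1) * jointSpectralRadius {A} * setNorm N {A} ^ (d - 1) := by
  have hb := isBoundedMatSet_singleton A
  set ρ := jointSpectralRadius {A} with hρ
  have hρ0 : 0 ≤ ρ := jointSpectralRadius_nonneg hb
  have hρa : ρ ≤ setNorm N {A} := jointSpectralRadius_le_setNorm hb hN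
  rw [Set.singleton_pow]
  set a := setNorm N {A} with ha
  have ha0 : 0 ≤ a := setNorm_nonneg _ _
  have h2 : (0 : ℝ) ≤ 2 ^ d - 1 := sub_nonneg.2 (one_le_pow₀ one_le_two)
  refine setNorm_le (by positivity) ?_
  rintro _ rfl v
  have hpow : ∀ n : ℕ, N ((A ^ n).mulVec v) ≤ a ^ n * N v := fun n => by
    induction n with
    | zero => simp
    | succ n ih =>
      rw [pow_succ', pow_succ', ← Matrix.mulVec_mulVec, mul_assoc]
      exact (map_mulVec_le_setNorm hb hN rfl _).trans (by gcongr)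
  have hdeg : A.charpoly.natDegree = d := by
    rw [Matrix.charpoly_natDegree_eq_dim, Fintype.card_fin]
  have hcoeff : ∀ i, ‖A.charpoly.coeff i‖ ≤ ρ ^ (d - i) * d.choose i := fun i => by
    have := Polynomial.coeff_le_of_roots_le (f := RingHom.id ℂ) (B := ρ) i A.charpoly_monic
      (IsAlgClosed.splits _) (fun z hz => by
        rw [Polynomial.map_id] at hz
        exact norm_le_jointSpectralRadius_of_isRoot_charpoly (Polynomial.isRoot_of_mem_roots hz))
    rwa [Polynomial.map_id, hdeg] at this
  have hCH : A ^ d = -∑ i ∈ Finset.range d, A.charpoly.coeff i • A ^ i := by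
    have h1 := A.aeval_self_charpoly
    rw [A.charpoly_monic.as_sum, hdeg] at h1
    simp only [map_add, map_sum, map_mul, map_pow, Polynomial.aeval_X, Polynomial.aeval_C,
      Algebra.algebraMap_eq_smul_one, smul_one_mul] at h1
    exact eq_neg_of_add_eq_zero_left h1
  have hsum : ∑ i ∈ Finset.range d, (d.choose i : ℝ) = 2 ^ d - 1 := by
    have := Nat.sum_range_choose d
    rw [Finset.sum_range_succ, Nat.choose_self] at this
    rw [eq_sub_iff_add_eq]
    exact_mod_cast this
  rw [hCH, Matrix.neg_mulVec, map_neg_eq_map, Matrix.sum_mulVec]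
  calc N (∑ i ∈ Finset.range d, (A.charpoly.coeff i • A ^ i).mulVec v)
      ≤ ∑ i ∈ Finset.range d, N ((A.charpoly.coeff i • A ^ i).mulVec v) :=
        Finset.le_sum_of_subadditive N (map_zero N).le (map_add_le_add N) _ _
    _ ≤ ∑ i ∈ Finset.range d, (d.choose i : ℝ) * (ρ * a ^ (d - 1) * N v) := by
        refine Finset.sum_le_sum fun i hi => ?_
        have hi' := Finset.mem_range.1 hi
        rw [Matrix.smul_mulVec, map_smul_eq_mul]
        calc ‖A.charpoly.coeff i‖ * N ((A ^ i).mulVec v)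
            ≤ ρ ^ (d - i) * d.choose i * (a ^ i * N v) := by
              gcongr
              · exact hcoeff i
              · exact hpow i
          _ = d.choose i * (ρ * (ρ ^ (d - 1 - i) * a ^ i) * N v) := by
              rw [show d - i = (d - 1 - i) + 1 by omega, pow_succ]
              ring
          _ ≤ d.choose i * (ρ * (a ^ (d - 1 - i) * a ^ i) * N v) := by gcongr
          _ = _ := by rw [← pow_add, show d - 1 - i + i = d - 1 by omega]
    _ = _ := by
        rw [← Finset.sum_mul, hsum]
        ring

/-- Bochi's inequality for the sets `𝒜 ^ m`. If `𝒜` has more than one element, `𝒜 ^ m` may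
nevertheless be a singleton, but the larger constant is valid for every bounded set. -/
theorem setNorm_pow_pow_le_bochiConst_mul (hd : 2 ≤ d) {𝒜 : Set (Matrix (Fin d) (Fin d) ℂ)}
    (h𝒜 : IsBoundedMatSet 𝒜) {N : Seminorm ℂ (Fin d → ℂ)} (hN : ∀ v, N v = 0 → v = 0) {m : ℕ}
    (hm : 1 ≤ m) :
    setNorm N (𝒜 ^ (d * m)) ≤
      bochiConst d 𝒜.encard * jointSpectralRadius 𝒜 ^ m * setNorm N (𝒜 ^ m) ^ (d - 1) := by
  rw [mul_comm d m, pow_mul, ← jointSpectralRadius_pow h𝒜 hm, bochiConst]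
  split_ifs with h
  · obtain ⟨A, rfl⟩ := Set.encard_eq_one.1 h
    rw [Set.singleton_pow]
    exact setNorm_singleton_pow_le (by omega) _ hN
  · exact setNorm_pow_le_rpow_mul hd (h𝒜.pow m) hN

theorem one_le_bochiConst (hd : 2 ≤ d) (r : ℕ∞) : 1 ≤ bochiConst d r := by
  have hd' : (1 : ℝ) ≤ d := by exact_mod_cast (by omega : 1 ≤ d)
  rw [bochiConst]
  split_ifs
  · have : (2 : ℝ) ^ 1 ≤ 2 ^ d := pow_le_pow_right₀ one_le_two (by omega)
    linarith
  · exact Real.one_le_rpow hd' (by positivity)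

end Singleton

/-! ### Iteration along the base-`d` expansion of the exponent -/

/-- The power of the Bochi constant collected for exponents with at most `k + 1` digits in base
`d = x + 1`. -/
def constExponent (x : ℕ) : ℕ → ℕ
  | 0 => x
  | k + 1 => x * constExponent x k + (x + 1)

/-- The power of `‖𝒜‖ᵈ / ‖𝒜ᵈ‖` collected for exponents with at most `k + 1` digits in base
`d = x + 1`. -/
def ratioExponent (x : ℕ) : ℕ → ℕ
  | 0 => x
  | k + 1 => x * ratioExponent x k + x

theorem le_constExponent (x k : ℕ) : x ≤ constExponent x k := by
  cases k with
  | zero => exact le_rfl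
  | succ k => rw [constExponent]; omega

theorem le_ratioExponent (x k : ℕ) : x ≤ ratioExponent x k := by
  cases k with
  | zero => exact le_rfl
  | succ k => rw [ratioExponent]; omega

/-- Writing `n = d q + r` with a digit `r`, one has `a n ≤ C a(q)^(d-1) a(1)^r`. -/
theorem le_pow_constExponent_mul_pow_ratioExponent {a : ℕ → ℝ} (ha : ∀ n, 0 ≤ a n) (ha0 : a 0 ≤ 1)
    (hsub : ∀ m n, a (m + n) ≤ a m * a n) {d : ℕ} (hd : 2 ≤ d) {C κ : ℝ} (hC : 1 ≤ C) (hκ : 1 ≤ κ)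
    (ha1 : a 1 ≤ C * κ) (hmul : ∀ m, 1 ≤ m → a (d * m) ≤ C * a m ^ (d - 1)) (k : ℕ) :
    ∀ n, n < d ^ (k + 1) → a n ≤ C ^ constExponent (d - 1) k * κ ^ ratioExponent (d - 1) k := by
  have hC0 : 0 ≤ C := by linarith
  have hκ0 : 0 ≤ κ := by linarith
  have hCκ : 1 ≤ C * κ := one_le_mul_of_one_le_of_one_le hC hκ
  have hpow : ∀ n, a n ≤ (C * κ) ^ n := fun n => by
    induction n with
    | zero => simpa using ha0
    | succ n ih =>
      rw [pow_succ]
      exact (hsub n 1).trans (mul_le_mul ih ha1 (ha 1) (by positivity))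
  have hsmall : ∀ r, r < d → a r ≤ C ^ (d - 1) * κ ^ (d - 1) := fun r hr => by
    rw [← mul_pow]
    exact (hpow r).trans (pow_le_pow_right₀ hCκ (by omega))
  induction k with
  | zero =>
    intro n hn
    exact hsmall n (by simpa using hn)
  | succ k ih =>
    intro n hn
    have hr : n % d < d := Nat.mod_lt _ (by omega)
    rcases Nat.eq_zero_or_pos (n / d) with hq | hq
    · have hn' : n < d := (Nat.div_eq_zero_iff_lt (by omega)).1 hq
      refine (hsmall n hn').trans ?_
      gcongr
      · exact le_constExponent _ _
      · exact le_ratioExponent _ _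
    · have hqk : n / d < d ^ (k + 1) := Nat.div_lt_of_lt_mul (by rwa [← pow_succ'])
      have h1 := ih (n / d) hqk
      have hn' : n = d * (n / d) + n % d := (Nat.div_add_mod n d).symm
      calc a n ≤ a (d * (n / d)) * a (n % d) := by
            conv_lhs => rw [hn']
            exact hsub _ _
        _ ≤ C * (C ^ constExponent (d - 1) k * κ ^ ratioExponent (d - 1) k) ^ (d - 1) *
              (C ^ (d - 1) * κ ^ (d - 1)) := by
            refine mul_le_mul ((hmul _ hq).trans ?_) (hsmall _ hr) (ha _) (by positivity)
            gcongr
            exact ha _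
        _ = _ := by
            rw [constExponent, ratioExponent]
            ring

theorem constExponent_one (k : ℕ) : constExponent 1 k = 2 * k + 1 := by
  induction k with
  | zero => rfl
  | succ k ih => rw [constExponent, ih]; ring

theorem ratioExponent_one (k : ℕ) : ratioExponent 1 k = k + 1 := by
  induction k with
  | zero => rfl
  | succ k ih => rw [ratioExponent, ih]; ring

theorem sub_one_mul_constExponent_add (x k : ℕ) :
    ((x : ℝ) - 1) * constExponent x k + (x + 1) = (x : ℝ) ^ k * (x ^ 2 + 1) := by
  induction k with
  | zero => simp only [constExponent]; ring
  | succ k ih =>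
    rw [constExponent, pow_succ]
    push_cast
    linear_combination (x : ℝ) * ih

theorem sub_one_mul_ratioExponent_add (x k : ℕ) :
    ((x : ℝ) - 1) * ratioExponent x k + x = (x : ℝ) ^ k * x ^ 2 := by
  induction k with
  | zero => simp only [ratioExponent]; ring
  | succ k ih =>
    rw [ratioExponent, pow_succ]
    push_cast
    linear_combination (x : ℝ) * ih

theorem pow_natLog_le_rpow {d n : ℕ} (hd : 2 < d) (hn : 1 ≤ n) :
    ((d : ℝ) - 1) ^ Nat.log d n ≤ (n : ℝ) ^ (Real.log ((d : ℝ) - 1) / Real.log d) := by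
  have hd' : (3 : ℝ) ≤ d := by exact_mod_cast hd
  have hlog : 0 < Real.log d := Real.log_pos (by linarith)
  have hlog' : 0 < Real.log ((d : ℝ) - 1) := Real.log_pos (by linarith)
  have h1 : (d : ℝ) ^ (Real.log ((d : ℝ) - 1) / Real.log d) = (d : ℝ) - 1 := by
    rw [Real.rpow_def_of_pos (by linarith), mul_div_cancel₀ _ hlog.ne', Real.exp_log (by linarith)]
  have h2 : ((d : ℝ) ^ Nat.log d n) ≤ n := by
    exact_mod_cast Nat.pow_log_le_self d (by omega)
  calc ((d : ℝ) - 1) ^ Nat.log d n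
      = ((d : ℝ) ^ Nat.log d n) ^ (Real.log ((d : ℝ) - 1) / Real.log d) := by
        rw [← Real.rpow_pow_comm (by linarith), h1]
    _ ≤ _ := Real.rpow_le_rpow (by positivity) h2 (by positivity)

theorem natLog_two_le (n : ℕ) : (Nat.log 2 n : ℝ) ≤ Real.log n / Real.log 2 := by
  exact_mod_cast Real.natLog_le_logb n 2

theorem constExponent_le_sigmaExp {d n : ℕ} (hd : 2 ≤ d) (hn : 1 ≤ n) :
    (constExponent (d - 1) (Nat.log d n) : ℝ) ≤ sigmaExp d n := by
  rw [sigmaExp]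
  split_ifs with h2
  · subst h2
    have h1 := natLog_two_le n
    rw [show 2 - 1 = 1 from rfl, constExponent_one]
    set k := Nat.log 2 n
    have hk : (k : ℝ) ≤ (k : ℝ) ^ 2 := by exact_mod_cast Nat.le_self_pow two_ne_zero k
    have hk0 : (0 : ℝ) ≤ k := by positivity
    push_cast
    nlinarith
  · have hd2 : 2 < d := by omega
    have hd' : (3 : ℝ) ≤ d := by exact_mod_cast hd2
    have h1 := sub_one_mul_constExponent_add (d - 1) (Nat.log d n)
    rw [Nat.cast_sub (by omega), Nat.cast_one] at h1
    have h3 := pow_natLog_le_rpow hd2 hn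
    refine le_trans ?_ (mul_le_mul_of_nonneg_left h3 (div_nonneg (pow_nonneg (by linarith) 3)
      (sq_nonneg _)))
    have hp : 0 ≤ ((d : ℝ) - 1) ^ Nat.log d n := pow_nonneg (by linarith) _
    set p := ((d : ℝ) - 1) ^ Nat.log d n
    set S : ℝ := (constExponent (d - 1) (Nat.log d n) : ℝ)
    have hpos : 0 < (d : ℝ) - 2 := by linarith
    rw [div_mul_eq_mul_div, le_div_iff₀ (by positivity)]
    have h4 : S * ((d : ℝ) - 2) ≤ p * (((d : ℝ) - 1) ^ 2 + 1) := by linarith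
    calc S * ((d : ℝ) - 2) ^ 2 = S * ((d : ℝ) - 2) * ((d : ℝ) - 2) := by ring
      _ ≤ p * (((d : ℝ) - 1) ^ 2 + 1) * ((d : ℝ) - 2) := by gcongr
      _ = p * ((((d : ℝ) - 1) ^ 2 + 1) * ((d : ℝ) - 2)) := by ring
      _ ≤ p * ((d : ℝ) - 1) ^ 3 := by
          gcongr
          nlinarith
      _ = _ := by ring

theorem ratioExponent_le_nuExp {d n : ℕ} (hd : 2 ≤ d) (hn : 1 ≤ n) :
    (ratioExponent (d - 1) (Nat.log d n) : ℝ) ≤ nuExp d n := by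
  rw [nuExp]
  split_ifs with h2
  · subst h2
    rw [show 2 - 1 = 1 from rfl, ratioExponent_one]
    push_cast
    linarith [natLog_two_le n]
  · have hd2 : 2 < d := by omega
    have hd' : (3 : ℝ) ≤ d := by exact_mod_cast hd2
    have h1 := sub_one_mul_ratioExponent_add (d - 1) (Nat.log d n)
    rw [Nat.cast_sub (by omega), Nat.cast_one] at h1
    have h3 := pow_natLog_le_rpow hd2 hn
    have hpos : 0 < (d : ℝ) - 2 := by linarith
    refine le_trans ?_ (mul_le_mul_of_nonneg_left h3 (div_nonneg (sq_nonneg _) hpos.le))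
    rw [div_mul_eq_mul_div, le_div_iff₀ hpos]
    linarith

theorem setNorm_pow_le_mul_jointSpectralRadius_pow {d : ℕ} (hd : 2 ≤ d)
    {𝒜 : Set (Matrix (Fin d) (Fin d) ℂ)} (hne : 𝒜.Nonempty) (hbdd : IsBoundedMatSet 𝒜)
    {N : Seminorm ℂ (Fin d → ℂ)} (hN : ∀ v, N v = 0 → v = 0) (h0 : 𝒜 ^ d ≠ {0}) {n : ℕ}
    (hn : 1 ≤ n) :
    setNorm N (𝒜 ^ n) ≤ bochiConst d 𝒜.encard ^ sigmaExp d n *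
      (setNorm N 𝒜 ^ d / setNorm N (𝒜 ^ d)) ^ nuExp d n * jointSpectralRadius 𝒜 ^ n := by
  set C := bochiConst d 𝒜.encard
  set ρ := jointSpectralRadius 𝒜
  have hC : 1 ≤ C := one_le_bochiConst hd _
  have hC0 : 0 < C := by linarith
  have hpos : 0 < setNorm N (𝒜 ^ d) := setNorm_pos (hbdd.pow d) (hne.pow) h0 hN
  have hbochi : setNorm N (𝒜 ^ d) ≤ C * ρ * setNorm N 𝒜 ^ (d - 1) := by
    simpa using setNorm_pow_pow_le_bochiConst_mul hd hbdd hN le_rfl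
  have ha := setNorm_nonneg N 𝒜
  have hρ : 0 < ρ := by
    refine (jointSpectralRadius_nonneg hbdd).lt_of_ne fun h => ?_
    change 0 = ρ at h
    rw [← h, mul_zero, zero_mul] at hbochi
    exact hbochi.not_gt hpos
  have hpow : ∀ k, setNorm N (𝒜 ^ k) ≤ setNorm N 𝒜 ^ k := fun k => by
    induction k with
    | zero => simpa using setNorm_pow_zero_le 𝒜 N
    | succ k ih =>
      rw [pow_succ (setNorm N 𝒜)]
      refine (setNorm_pow_add_le hbdd hN k 1).trans ?_
      rw [pow_one]
      gcongr
  set κ := setNorm N 𝒜 ^ d / setNorm N (𝒜 ^ d)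
  have hκ : 1 ≤ κ := (one_le_div hpos).2 (hpow d)
  have hpow_d : ∀ y : ℝ, y ^ d = y ^ (d - 1) * y := fun y => (pow_sub_one_mul (by omega) y).symm
  have key := le_pow_constExponent_mul_pow_ratioExponent
    (a := fun n => setNorm N (𝒜 ^ n) / ρ ^ n)
    (fun n => div_nonneg (setNorm_nonneg _ _) (by positivity))
    (by simpa using setNorm_pow_zero_le 𝒜 N)
    (fun m n => by
      rw [div_mul_div_comm, pow_add ρ]
      gcongr
      exact setNorm_pow_add_le hbdd hN m n)
    hd hC hκ
    (by
      rw [pow_one, pow_one, div_le_iff₀ hρ, ← mul_div_assoc, div_mul_eq_mul_div,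
        le_div_iff₀ hpos]
      refine (mul_le_mul_of_nonneg_left hbochi ha).trans (le_of_eq ?_)
      rw [hpow_d]
      ring)
    (fun m hm => by
      have hs := setNorm_pow_pow_le_bochiConst_mul hd hbdd hN hm
      change _ ≤ C * ρ ^ m * _ at hs
      have hρm : ρ ^ (d * m) = ρ ^ m * (ρ ^ m) ^ (d - 1) := by
        rw [mul_comm d, pow_mul, hpow_d, mul_comm]
      rw [hρm, div_pow, div_le_iff₀ (by positivity)]
      refine hs.trans (le_of_eq ?_)
      field_simp)
    (Nat.log d n) n (Nat.lt_pow_succ_log_self (by omega) n)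
  rw [div_le_iff₀ (by positivity)] at key
  refine key.trans ?_
  rw [← Real.rpow_natCast C, ← Real.rpow_natCast κ]
  have hκ0 : 0 < κ := by linarith
  gcongr
  · exact constExponent_le_sigmaExp hd hn
  · exact ratioExponent_le_nuExp hd hn

theorem theorem1 (d : ℕ) (hd : 2 ≤ d)
    (𝒜 : Set (Matrix (Fin d) (Fin d) ℂ)) (hne : 𝒜.Nonempty) (hbdd : IsBoundedMatSet 𝒜)
    (N : Seminorm ℂ (Fin d → ℂ)) (hN : ∀ v, N v = 0 → v = 0) :
    Tendsto (fun n : ℕ => setNorm N (𝒜 ^ n) ^ (1 / (n : ℝ))) atTop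
      (𝓝 (jointSpectralRadius 𝒜)) ∧
    ∀ n : ℕ, 1 ≤ n →
      (𝒜 ^ d ≠ {0} →
        bochiConst d 𝒜.encard ^ (-(sigmaExp d n / n)) *
            (setNorm N 𝒜 ^ d / setNorm N (𝒜 ^ d)) ^ (-(nuExp d n / n)) *
            setNorm N (𝒜 ^ n) ^ (1 / (n : ℝ))
          ≤ jointSpectralRadius 𝒜) ∧
      jointSpectralRadius 𝒜 ≤ setNorm N (𝒜 ^ n) ^ (1 / (n : ℝ)) := by
  refine ⟨tendsto_jointSpectralRadius hbdd hN, fun n hn => ⟨fun h0 => ?_,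
    jointSpectralRadius_le hbdd hN hn⟩⟩
  have h := setNorm_pow_le_mul_jointSpectralRadius_pow hd hne hbdd hN h0 hn
  have hC : 0 < bochiConst d 𝒜.encard := one_pos.trans_le (one_le_bochiConst hd _)
  have hκ : 0 ≤ setNorm N 𝒜 ^ d / setNorm N (𝒜 ^ d) :=
    div_nonneg (pow_nonneg (setNorm_nonneg _ _) _) (setNorm_nonneg _ _)
  have hρ := jointSpectralRadius_nonneg hbdd
  have hn0 : (n : ℝ) ≠ 0 := by positivity
  set C := bochiConst d 𝒜.encard
  set κ := setNorm N 𝒜 ^ d / setNorm N (𝒜 ^ d)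
  set ρ := jointSpectralRadius 𝒜
  have h1 : setNorm N (𝒜 ^ n) ^ (1 / (n : ℝ)) ≤
      C ^ (sigmaExp d n / n) * κ ^ (nuExp d n / n) * ρ := by
    refine (Real.rpow_le_rpow (setNorm_nonneg _ _) h (by positivity)).trans (le_of_eq ?_)
    rw [Real.mul_rpow (by positivity) (by positivity), Real.mul_rpow (by positivity) (by positivity),
      ← Real.rpow_mul hC.le, ← Real.rpow_mul hκ, ← Real.rpow_natCast ρ, ← Real.rpow_mul hρ,
      mul_one_div_cancel hn0, Real.rpow_one, mul_one_div, mul_one_div]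
  rw [Real.rpow_neg hC.le, Real.rpow_neg hκ]
  have hC' : 0 < C ^ (sigmaExp d n / n) := Real.rpow_pos_of_pos hC _
  rcases (Real.rpow_nonneg hκ (nuExp d n / n)).eq_or_lt with hz | hp
  · rw [← hz, inv_zero, mul_zero, zero_mul]
    exact hρ
  · rw [← mul_inv, inv_mul_le_iff₀ (by positivity)]
    exact h1
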